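/- Let $K$ be a finite simplicial complex whose geometric realization is connected (in particular non-empty), with set of vertices $V$. A \emph{Golomb ruler} with marks indexed by $V$ is an injective map $a\colon V\to\mathbb{Z}_{\ge 0}$ such that $a_j-a_i=a_{j'}-a_{i'}$ implies $i=j$ or $j=j'$. Call an integer $n\ge 1$ \emph{admissible} for $a$ if $n>2a_v$ for all $v\in V$, if $n$ is coprime to $a_w-a_v$ whenever $a_v<a_w$, and if $n=1$ in the case that $K$ has only one vertex. For such $a$ and $n$ let $\widetilde K_{a,n}$ be the simplicial complex with vertex set $\mathbb{Z}/n$ whose faces are the sets $\{x+a_v : v\in\sigma\}\subseteq\mathbb{Z}/n$, where $x\in\mathbb{Z}/n$ and $\sigma$ is a face of $K$. A simplicial complex is called \emph{$\Gamma$-vertex-transitive} if some subgroup of its automorphism group that is isomorphic to $\Gamma$ acts transitively on its vertices. (a) There exist an integer $n\ge 1$, a $\mathbb{Z}/n$-vertex-transitive simplicial complex $\widetilde K$ with $n$ vertices and an integer $l\ge 0$ with a homotopy equivalence $$\widetilde K\simeq \bigvee^n K\vee\bigvee^l S^1 ;$$ moreover one can take $\widetilde K=\widetilde K_{a,n}$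 for some Golomb ruler $a$ with marks indexed by $V$ and some $n$ admissible for $a$. (b) For every Golomb ruler $a$ with marks indexed by $V$ and every $n$ admissible for $a$, the complex $\widetilde K_{a,n}$ is $\mathbb{Z}/n$-vertex-transitive, and there is an integer $l\ge 0$ with $\widetilde K_{a,n}\simeq \bigvee^n K\vee\bigvee^l S^1$. Here the wedges may be formed at any chosen point of $K$ (the same in every copy), and $l$ does not depend on that choice. -/

import Mathlib

open scoped ContinuousMap

namespace CyclicComplex

/-- The geometric realization of a simplicial complex with finite vertex set `V`, as a subspace of
`V → ℝ`: the points of the standard simplex (barycentric coordinates) whose support lies in a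
face. -/
def realization {V : Type*} [Fintype V] (K : AbstractSimplicialComplex V) : Set (V → ℝ) :=
  {x | x ∈ stdSimplex ℝ V ∧ ∃ s ∈ K.faces, ∀ v, x v ≠ 0 → v ∈ s}

/-- The group of automorphisms of a simplicial complex: the bijections of the vertex set that
preserve faces in both directions. -/
def aut {V : Type*} (K : AbstractSimplicialComplex V) : Subgroup (Equiv.Perm V) where
  carrier := {e | ∀ s : Finset V, s.map e.toEmbedding ∈ K.faces ↔ s ∈ K.faces}
  one_mem' := by
    intro s
    have : s.map (1 : Equiv.Perm V).toEmbedding = s := by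
      ext; simp; rfl
    rw [this]
  mul_mem' := by
    intro e f he hf s
    have : s.map (e * f).toEmbedding = (s.map f.toEmbedding).map e.toEmbedding := by
      ext; simp; rfl
    rw [this, he, hf]
  inv_mem' := by
    intro e he s
    have : (s.map (e⁻¹).toEmbedding).map e.toEmbedding = s := by
      rw [Finset.map_map]
      have : (e⁻¹).toEmbedding.trans e.toEmbedding = Function.Embedding.refl V := by
        ext; simp
      rw [this, Finset.map_refl]
    rw [← he, this]

/-- `K` is `Γ`-vertex-transitive: some subgroup of `Aut(K)`, isomorphic to `Γ`, acts transitively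
on the vertices of `K`. -/
def IsVertexTransitive (Γ : Type*) [Group Γ] {V : Type*} (K : AbstractSimplicialComplex V) :
    Prop :=
  ∃ H : Subgroup (Equiv.Perm V), H ≤ aut K ∧ Nonempty (Γ ≃* H) ∧ ∀ v w : V, ∃ g ∈ H, g v = w

/-- The equivalence relation that identifies all points of `A` with one another (and nothing
else). -/
def collapse {X : Type*} (A : Set X) : Setoid X where
  r x y := x = y ∨ (x ∈ A ∧ y ∈ A)
  iseqv :=
    { refl := fun _ => Or.inl rfl
      symm := by
        rintro x y (h | ⟨hx, hy⟩)
        · exact Or.inl h.symm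
        · exact Or.inr ⟨hy, hx⟩
      trans := by
        rintro x y z (rfl | ⟨hx, hy⟩) (rfl | ⟨hy', hz⟩)
        · exact Or.inl rfl
        · exact Or.inr ⟨hy', hz⟩
        · exact Or.inr ⟨hx, hy⟩
        · exact Or.inr ⟨hx, hz⟩ }

/-- The wedge `X ∨ Y` of two pointed spaces `(X, x₀)` and `(Y, y₀)`, with the quotient topology. -/
abbrev Wedge (X Y : Type*) [TopologicalSpace X] [TopologicalSpace Y] (x₀ : X) (y₀ : Y) : Type _ :=
  Quotient (collapse ({Sum.inl x₀, Sum.inr y₀} : Set (X ⊕ Y)))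

/-- The wedge of `n` copies of the pointed space `(X, x₀)`: the disjoint union of a point and
`Fin n × X`, where the point and all the copies of `x₀` are identified. It is a point if `n = 0`. -/
abbrev WedgeCopies (n : ℕ) (X : Type*) [TopologicalSpace X] (x₀ : X) : Type _ :=
  Quotient (collapse
    ({Sum.inl ()} ∪ Set.range fun i : Fin n => Sum.inr (i, x₀) : Set (Unit ⊕ (Fin n × X))))

/-- The base point of a wedge of copies. -/
abbrev WedgeCopies.base (n : ℕ) (X : Type*) [TopologicalSpace X] (x₀ : X) : WedgeCopies n X x₀ :=
  Quotient.mk _ (Sum.inl ())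

/-- The wedge of `n` copies of `(X, x₀)` and `l` circles. -/
abbrev WedgeWithCircles (n l : ℕ) (X : Type*) [TopologicalSpace X] (x₀ : X) : Type _ :=
  Wedge (WedgeCopies n X x₀) (WedgeCopies l Circle 1)
    (WedgeCopies.base n X x₀) (WedgeCopies.base l Circle 1)

/-- The integers `a v ≥ 0`, indexed by the finite set `V`, are the marks of a Golomb ruler. -/
def IsGolombRuler {V : Type*} (a : V → ℕ) : Prop :=
  Function.Injective a ∧
    ∀ i j i' j' : V, (a j : ℤ) - a i = (a j' : ℤ) - a i' → i = j ∨ j = j'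

/-- The modulus `n` is admissible for the ruler `a`: it exceeds twice every mark and is coprime to
all the differences of marks. For a ruler with only one mark the second condition is void, and
we ask for `n = 1` instead. -/
def IsAdmissibleModulus {V : Type*} (a : V → ℕ) (n : ℕ) : Prop :=
  (∀ v, 2 * a v < n) ∧ (∀ v w, a v < a w → Nat.Coprime n (a w - a v)) ∧ (Subsingleton V → n = 1)

/-- The complex with vertex set `ℤ/n` whose faces are the sets `{x + a v : v ∈ s}`, for `x ∈ ℤ/n`
and `s` a face of `K`. -/
def cyclicComplex {V : Type*} [Nonempty V] (K : AbstractSimplicialComplex V) (a : V → ℕ) (n : ℕ) :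
    AbstractSimplicialComplex (ZMod n) where
  faces := {t | ∃ x : ZMod n, ∃ s ∈ K.faces, t = s.image fun v => x + (a v : ZMod n)}
  isRelLowerSet_faces := by
    rintro t ⟨x, s, hs, rfl⟩
    refine ⟨(K.isRelLowerSet_faces hs).1.image _, ?_⟩
    intro u hu hne
    obtain ⟨s', hs', rfl⟩ := Finset.subset_image_iff.mp hu
    exact ⟨x, s', (K.isRelLowerSet_faces hs).2 hs' (Finset.image_nonempty.mp hne), rfl⟩
  singleton_mem := by
    intro y
    obtain ⟨v⟩ := ‹Nonempty V›
    exact ⟨y - a v, {v}, K.singleton_mem v, by simp⟩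

end CyclicComplex

/-!
Let `X` be the disjoint union of the `n` translates `x + K`, for `x` in `ℤ/n`. Modulo an admissible
`n` the marks of the ruler still have distinct differences, so that two different translates share
at most one vertex, and the cyclic complex is `X` with some vertices identified: after the choice of
`v₀ : V`, the vertex `v ≠ v₀` of the translate by `x` becomes the vertex `v₀` of the translate by
`x + a v - a v₀`.

Identifying two points has, up to homotopy, the same effect as attaching an arc between them. So
the cyclic complex is homotopy equivalent to `X` with one arc attached for each of these
identifications (`AttachArcs.nonempty_homotopyEquiv_of_identify`). Since `K` is path-connected, the
ends of the arcs may slide inside the translates without changing the homotopy type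
(`AttachArcs.nonempty_homotopyEquiv_of_joined`), and all of them are brought to the chosen point `p`
of the translate in which they lie. As the differences of marks are units modulo `n`, some of the
arcs form a chain that visits each translate exactly once (`exists_chain_order`); its collapse turns
the `n` translates into a wedge of copies of `K`, and the other arcs into circles
(`nonempty_homotopyEquiv_wedge`). Their number `n (|V| - 1) - (n - 1)` does not depend on `p`.

The collapses are homotopy equivalences because homotopies extend from finite sets of points to the
whole realization. This is deduced from an explicit deformation of a neighbourhood of such points
(`exists_isDeformationNhd`, `IsDeformationNhd.exists_extension`), which also gives the
path-connectedness. A homotopy on a space with attached arcs is handled as a map into the space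
of paths `C(I, Y)`, so that no product of a quotient space with the interval is needed.
-/

namespace CyclicComplex
open unitInterval Topology

/-! ### Homotopies into curried mapping spaces -/

section Curried

variable {Y Q : Type*} [TopologicalSpace Y] [TopologicalSpace Q]

/-- A continuous family of paths is a homotopy between its two ends. -/
theorem homotopic_of_curried {f g : C(Y, Q)} (H : C(Y, C(I, Q))) (h₀ : ∀ y, H y 0 = f y)
    (h₁ : ∀ y, H y 1 = g y) : f.Homotopic g :=
  ⟨{ toContinuousMap := H.uncurry.comp ⟨Prod.swap, continuous_swap⟩
     map_zero_left := h₀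
     map_one_left := h₁ }⟩

/-- A quotient map `q` is a homotopy equivalence as soon as the identity of its source deforms,
through maps compatible with `q`, to a map that is constant on the fibres of `q`. All the
nontrivial fibres of `q` are assumed to lie in a set `S` on which the deformation stays in the
fibres. -/
theorem nonempty_homotopyEquiv_of_collapse (q : C(Y, Q)) (hq : IsQuotientMap q)
    (H : C(Y, C(I, Y))) (h₀ : ∀ y, H y 0 = y) (S : Set Y)
    (hS : ∀ y y', q y = q y' → y = y' ∨ (y ∈ S ∧ y' ∈ S))
    (hH : ∀ y ∈ S, ∀ t, q (H y t) = q y)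
    (h₁ : ∀ y ∈ S, ∀ y' ∈ S, q y = q y' → H y 1 = H y' 1) : Nonempty (Y ≃ₕ Q) := by
  let e₁ : C(Y, Y) := ⟨fun y => H y 1, by fun_prop⟩
  have hfac : Function.FactorsThrough e₁ q := by
    intro y y' h
    rcases hS y y' h with rfl | ⟨hy, hy'⟩
    · rfl
    · exact h₁ y hy y' hy' h
  let qH : C(Y, C(I, Q)) :=
    ⟨fun y => q.comp (H y), (ContinuousMap.continuous_postcomp q).comp H.continuous⟩
  have hfac' : Function.FactorsThrough qH q := by
    intro y y' h
    rcases hS y y' h with rfl | ⟨hy, hy'⟩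
    · rfl
    · ext t
      exact (hH y hy t).trans (h.trans (hH y' hy' t).symm)
  let s : C(Q, Y) := hq.lift e₁ hfac
  have hs : ∀ y, s (q y) = H y 1 := fun y => DFunLike.congr_fun (hq.lift_comp e₁ hfac) y
  let K : C(Q, C(I, Q)) := hq.lift qH hfac'
  have hK : ∀ y, K (q y) = q.comp (H y) := fun y => DFunLike.congr_fun (hq.lift_comp qH hfac') y
  refine ⟨⟨q, s, ?_, ?_⟩⟩
  · exact (homotopic_of_curried H h₀ fun y => (hs y).symm).symm
  · refine (homotopic_of_curried K (f := ContinuousMap.id Q) ?_ ?_).symm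
    · intro x
      obtain ⟨y, rfl⟩ := hq.surjective x
      simp [hK, h₀]
    · intro x
      obtain ⟨y, rfl⟩ := hq.surjective x
      simp [hK, hs]

end Curried

/-! ### Attaching arcs to a space -/

section Arcs

variable {X E : Type*}

/-- The representative used to compare points of `X` and of the arcs: an end of the arc `e` is
replaced by the point of `X` to which it is attached. -/
noncomputable def arcNormalForm (φ₀ φ₁ : E → X) : (X ⊕ Σ _ : E, I) → (X ⊕ Σ _ : E, I)
  | Sum.inl x => Sum.inl x
  | Sum.inr ⟨e, s⟩ =>
    open Classical in
    if s = 0 then Sum.inl (φ₀ e) else if s = 1 then Sum.inl (φ₁ e) else Sum.inr ⟨e, s⟩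

/-- The space obtained from `X` by attaching, for each `e : E`, an arc from `φ₀ e` to `φ₁ e`. -/
def AttachArcs (φ₀ φ₁ : E → X) : Type _ :=
  Quotient (Setoid.ker (arcNormalForm φ₀ φ₁))

namespace AttachArcs

variable (φ₀ φ₁ : E → X)

/-- The quotient map from the disjoint union of `X` and the arcs. -/
noncomputable def mk (z : X ⊕ Σ _ : E, I) : AttachArcs φ₀ φ₁ := Quotient.mk _ z

theorem mk_eq_mk {z z' : X ⊕ Σ _ : E, I} :
    mk φ₀ φ₁ z = mk φ₀ φ₁ z' ↔ arcNormalForm φ₀ φ₁ z = arcNormalForm φ₀ φ₁ z' :=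
  Quotient.eq (r := Setoid.ker (arcNormalForm φ₀ φ₁))

variable [TopologicalSpace X]

noncomputable instance : TopologicalSpace (AttachArcs φ₀ φ₁) :=
  inferInstanceAs (TopologicalSpace (Quotient (Setoid.ker (arcNormalForm φ₀ φ₁))))

theorem continuous_mk : Continuous (mk φ₀ φ₁) := continuous_quotient_mk'

/-- The inclusion of `X`. -/
noncomputable def pt : C(X, AttachArcs φ₀ φ₁) :=
  ⟨fun x => mk φ₀ φ₁ (Sum.inl x), (continuous_mk φ₀ φ₁).comp continuous_inl⟩

/-- The arc `e`. -/
noncomputable def arc (e : E) : Path (pt φ₀ φ₁ (φ₀ e)) (pt φ₀ φ₁ (φ₁ e)) where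
  toFun s := mk φ₀ φ₁ (Sum.inr ⟨e, s⟩)
  continuous_toFun := (continuous_mk φ₀ φ₁).comp (continuous_inr.comp continuous_sigmaMk)
  source' := (mk_eq_mk φ₀ φ₁).2 (by simp [arcNormalForm])
  target' := (mk_eq_mk φ₀ φ₁).2 (by simp [arcNormalForm])

variable {φ₀ φ₁}

theorem ind {P : AttachArcs φ₀ φ₁ → Prop} (hpt : ∀ x, P (pt φ₀ φ₁ x))
    (harc : ∀ e s, P (arc φ₀ φ₁ e s)) (y : AttachArcs φ₀ φ₁) : P y := by
  induction y using Quotient.inductionOn with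
  | h z =>
    rcases z with x | ⟨e, s⟩
    · exact hpt x
    · exact harc e s

/-- A point of `AttachArcs` lies in `X` or in the interior of an arc. -/
theorem ind_interior {P : AttachArcs φ₀ φ₁ → Prop} (hpt : ∀ x, P (pt φ₀ φ₁ x))
    (harc : ∀ e s, s ≠ 0 → s ≠ 1 → P (arc φ₀ φ₁ e s)) (y : AttachArcs φ₀ φ₁) : P y := by
  refine ind hpt (fun e s => ?_) y
  by_cases h₀ : s = 0
  · rw [h₀, Path.source]; exact hpt _
  by_cases h₁ : s = 1
  · rw [h₁, Path.target]; exact hpt _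
  exact harc e s h₀ h₁

variable {Z : Type*} [TopologicalSpace Z]

/-- The map out of `AttachArcs` given by a map on `X` and a path on each arc. -/
noncomputable def desc (f : C(X, Z)) (δ : ∀ e, Path (f (φ₀ e)) (f (φ₁ e))) :
    C(AttachArcs φ₀ φ₁, Z) where
  toFun := Quotient.lift (Sum.elim f fun es : Σ _ : E, I => δ es.1 es.2) (by
    have key : ∀ z, Sum.elim f (fun es : Σ _ : E, I => δ es.1 es.2) (arcNormalForm φ₀ φ₁ z) =
        Sum.elim f (fun es : Σ _ : E, I => δ es.1 es.2) z := by
      rintro (x | ⟨e, s⟩)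
      · rfl
      · simp only [arcNormalForm]
        split_ifs with h₀ h₁
        · simp [h₀]
        · simp [h₁]
        · rfl
    intro z z' h
    rw [← key z, ← key z']
    exact congrArg _ h)
  continuous_toFun := by
    refine Continuous.quotient_lift ?_ _
    refine Continuous.sumElim f.continuous ?_
    exact continuous_sigma fun e => (δ e).continuous

@[simp] theorem desc_pt (f : C(X, Z)) (δ : ∀ e, Path (f (φ₀ e)) (f (φ₁ e))) (x : X) :
    desc f δ (pt φ₀ φ₁ x) = f x := rfl

@[simp] theorem desc_arc (f : C(X, Z)) (δ : ∀ e, Path (f (φ₀ e)) (f (φ₁ e))) (e : E) (s : I) :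
    desc f δ (arc φ₀ φ₁ e s) = δ e s := rfl

/-- Homotopic choices of the paths give homotopic maps. -/
theorem desc_homotopic (f : C(X, Z)) (δ δ' : ∀ e, Path (f (φ₀ e)) (f (φ₁ e)))
    (h : ∀ e, (δ e).Homotopic (δ' e)) : (desc f δ).Homotopic (desc f δ') := by
  let G := fun e => (h e).some
  let fc : C(X, C(I, Z)) := ⟨fun x => ContinuousMap.const I (f x),
    ContinuousMap.continuous_const'.comp f.continuous⟩
  let Gc : ∀ e, C(I, C(I, Z)) := fun e =>
    ((G e).toContinuousMap.comp ⟨Prod.swap, continuous_swap⟩).curry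
  have hG : ∀ e s t, Gc e s t = G e (t, s) := fun e s t => rfl
  let H : C(AttachArcs φ₀ φ₁, C(I, Z)) := desc fc fun e =>
    { toFun := Gc e
      continuous_toFun := (Gc e).continuous
      source' := by ext t; simp [hG, fc]
      target' := by ext t; simp [hG, fc] }
  refine homotopic_of_curried H ?_ ?_
  · refine ind (fun x => rfl) fun e s => ?_
    exact (hG e s 0).trans (by simp)
  · refine ind (fun x => rfl) fun e s => ?_
    exact (hG e s 1).trans (by simp)

theorem desc_self : desc (pt φ₀ φ₁) (arc φ₀ φ₁) = ContinuousMap.id _ := by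
  ext y
  exact ind (P := fun y => desc (pt φ₀ φ₁) (arc φ₀ φ₁) y = y) (fun _ => rfl) (fun _ _ => rfl) y

/-- Conjugating by a path and then by its inverse does nothing up to homotopy. -/
theorem _root_.Path.Homotopic.conj_conj {a a' b b' : Z} (α : Path a a') (β : Path b b')
    (γ : Path a b) :
    (α.trans ((α.symm.trans (γ.trans β)).trans β.symm)).Homotopic γ := by
  rw [← Path.Homotopic.Quotient.eq]
  simp only [Path.Homotopic.Quotient.mk_trans, Path.Homotopic.Quotient.mk_symm]
  simp only [Path.Homotopic.Quotient.trans_assoc, Path.Homotopic.Quotient.trans_symm,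
    Path.Homotopic.Quotient.trans_refl]
  rw [← Path.Homotopic.Quotient.trans_assoc, Path.Homotopic.Quotient.trans_symm,
    Path.Homotopic.Quotient.refl_trans]

/-- The map that slides the ends of the arcs along the paths `α` and `β`. -/
noncomputable def slide {ψ₀ ψ₁ : E → X} (α : ∀ e, Path (φ₀ e) (ψ₀ e))
    (β : ∀ e, Path (φ₁ e) (ψ₁ e)) : C(AttachArcs φ₀ φ₁, AttachArcs ψ₀ ψ₁) :=
  desc (pt ψ₀ ψ₁) fun e =>
    ((α e).map (pt ψ₀ ψ₁).continuous).trans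
      ((arc ψ₀ ψ₁ e).trans ((β e).map (pt ψ₀ ψ₁).continuous).symm)

theorem slide_slide_homotopic {ψ₀ ψ₁ : E → X} (α : ∀ e, Path (φ₀ e) (ψ₀ e))
    (β : ∀ e, Path (φ₁ e) (ψ₁ e)) :
    ((slide (fun e => (α e).symm) fun e => (β e).symm).comp (slide α β)).Homotopic
      (ContinuousMap.id _) := by
  set G : C(AttachArcs ψ₀ ψ₁, AttachArcs φ₀ φ₁) :=
    slide (fun e => (α e).symm) fun e => (β e).symm with hG
  have hcomp : G.comp (slide α β) = desc (pt φ₀ φ₁) fun e =>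
      ((α e).map (pt φ₀ φ₁).continuous).trans
        (((((α e).map (pt φ₀ φ₁).continuous).symm).trans
          ((arc φ₀ φ₁ e).trans ((β e).map (pt φ₀ φ₁).continuous))).trans
            ((β e).map (pt φ₀ φ₁).continuous).symm) := by
    ext y
    refine ind (P := fun y => G.comp (slide α β) y = desc _ _ y) (fun _ => rfl) (fun e s => ?_) y
    simp only [ContinuousMap.comp_apply, desc_arc, slide]
    have := DFunLike.congr_fun (Path.map_trans ((α e).map (pt ψ₀ ψ₁).continuous)
      ((arc ψ₀ ψ₁ e).trans ((β e).map (pt ψ₀ ψ₁).continuous).symm) G.continuous) s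
    refine this.trans ?_
    have h₁ : (arc ψ₀ ψ₁ e).map G.continuous = (((α e).map (pt φ₀ φ₁).continuous).symm).trans
        ((arc φ₀ φ₁ e).trans ((β e).map (pt φ₀ φ₁).continuous)) := by
      have h₂ : (((β e).symm.map (pt φ₀ φ₁).continuous)).symm =
          (β e).map (pt φ₀ φ₁).continuous := by ext; simp
      rw [← h₂]
      rfl
    rw [Path.map_trans, h₁]
    rfl
  rw [hcomp, ← desc_self]
  exact desc_homotopic _ _ _ fun e => Path.Homotopic.conj_conj _ _ _

/-- Sliding the ends of the attached arcs along paths in `X` preserves the homotopy type. -/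
theorem nonempty_homotopyEquiv_of_joined {ψ₀ ψ₁ : E → X} (h₀ : ∀ e, Joined (φ₀ e) (ψ₀ e))
    (h₁ : ∀ e, Joined (φ₁ e) (ψ₁ e)) :
    Nonempty (AttachArcs φ₀ φ₁ ≃ₕ AttachArcs ψ₀ ψ₁) := by
  let α := fun e => (h₀ e).somePath
  let β := fun e => (h₁ e).somePath
  refine ⟨⟨slide α β, slide (fun e => (α e).symm) fun e => (β e).symm,
    slide_slide_homotopic α β, ?_⟩⟩
  have := slide_slide_homotopic (fun e => (α e).symm) fun e => (β e).symm
  simpa only [Path.symm_symm] using this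

end AttachArcs

end Arcs

/-! ### Extending homotopies from a discrete set of points -/

section Extension

variable {X : Type*} [TopologicalSpace X]

/-- Near `A` the space `X` deforms into `A`: the deformation `e` starts at the identity, fixes `A`,
and has moved `x` into `A` from the time `u x` on. -/
structure IsDeformationNhd (A : Set X) (u : X → ℝ) (e : X → I → X) : Prop where
  continuous_u : Continuous u
  continuous_e : Continuous fun z : X × I => e z.1 z.2
  e_zero : ∀ x, e x 0 = x
  e_mem : ∀ x (t : I), u x ≤ t → e x t ∈ A
  u_eq_zero : ∀ a ∈ A, u a = 0
  e_fix : ∀ a ∈ A, ∀ t, e a t = a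
  u_nonneg : ∀ x, 0 ≤ u x

/-- The homotopy extension property for a discrete subset with a deformation neighbourhood. -/
theorem IsDeformationNhd.exists_extension {A : Set X} [DiscreteTopology A] {u : X → ℝ}
    {e : X → I → X} (h : IsDeformationNhd A u e) {Y : Type*} [TopologicalSpace Y] (F : C(X, Y))
    (γ : A → C(I, Y)) (hγ : ∀ a, γ a 0 = F a) :
    ∃ G : C(X, C(I, Y)), (∀ x, G x 0 = F x) ∧ ∀ a : A, G a = γ a := by
  classical
  -- A point first follows the deformation into `A`, and spends the rest of its time on the path
  -- prescribed at the point of `A` that it has reached.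
  let g : X × I → Y := fun z =>
    if hz : u z.1 ≤ z.2 then
      γ ⟨e z.1 z.2, h.e_mem _ _ hz⟩ (Set.projIcc 0 1 zero_le_one (z.2 - u z.1))
    else F (e z.1 z.2)
  have hle : IsClosed {z : X × I | u z.1 ≤ z.2} :=
    isClosed_le (h.continuous_u.comp continuous_fst) (continuous_subtype_val.comp continuous_snd)
  have hge : IsClosed {z : X × I | (z.2 : ℝ) ≤ u z.1} :=
    isClosed_le (continuous_subtype_val.comp continuous_snd) (h.continuous_u.comp continuous_fst)
  have hg₁ : ContinuousOn g {z : X × I | u z.1 ≤ z.2} := by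
    rw [continuousOn_iff_continuous_domRestrict]
    let k : {z : X × I | u z.1 ≤ z.2} → A × I := fun z =>
      (⟨e z.1.1 z.1.2, h.e_mem _ _ z.2⟩, Set.projIcc 0 1 zero_le_one (z.1.2 - u z.1.1))
    have hk : Continuous k := by
      refine Continuous.prodMk ?_ ?_
      · exact Continuous.subtype_mk (h.continuous_e.comp continuous_subtype_val) _
      · refine continuous_projIcc.comp ?_
        have := h.continuous_u
        fun_prop
    have hγc : Continuous fun z : A × I => γ z.1 z.2 := by
      rw [continuous_prod_of_discrete_left]
      exact fun a => (γ a).continuous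
    refine (hγc.comp hk).congr fun z => ?_
    have hz : u z.1.1 ≤ z.1.2 := z.2
    simp [g, k, hz]
  have hg₂ : ContinuousOn g {z : X × I | (z.2 : ℝ) ≤ u z.1} := by
    have : ContinuousOn (fun z : X × I => F (e z.1 z.2)) {z : X × I | (z.2 : ℝ) ≤ u z.1} :=
      (F.continuous.comp h.continuous_e).continuousOn
    refine this.congr fun z hz => ?_
    by_cases hz' : u z.1 ≤ z.2
    · have : (z.2 : ℝ) - u z.1 = 0 := by
        have : (z.2 : ℝ) ≤ u z.1 := hz
        linarith
      have h0 : Set.projIcc (0 : ℝ) 1 zero_le_one 0 = 0 := Set.projIcc_left zero_le_one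
      simp only [g, hz', dite_true, this, h0, hγ]
    · simp [g, hz']
  have hg : Continuous g := by
    rw [← continuousOn_univ]
    have := hg₁.union_of_isClosed hg₂ hle hge
    refine this.mono fun z _ => ?_
    exact le_total (u z.1) (z.2 : ℝ)
  refine ⟨(⟨g, hg⟩ : C(X × I, Y)).curry, fun x => ?_, fun a => ?_⟩
  · change g (x, 0) = F x
    by_cases hx : u x ≤ 0
    · have hz : u x = 0 := le_antisymm hx (h.u_nonneg x)
      simp [g, hz, hγ, h.e_zero]
    · simp [g, hx, h.e_zero]
  · ext t
    change g (a, t) = γ a t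
    have hu := h.u_eq_zero a a.2
    have : u a ≤ t := by rw [hu]; exact t.2.1
    simp [g, hu, t.2.1, h.e_fix a a.2]

/-- Deformation neighbourhoods pass to finite disjoint unions of copies. -/
theorem IsDeformationNhd.copies {A : Set X} {u : X → ℝ} {e : X → I → X}
    (h : IsDeformationNhd A u e) (n : ℕ) :
    IsDeformationNhd {z : Fin n × X | z.2 ∈ A} (fun z => u z.2) fun z t => (z.1, e z.2 t) where
  continuous_u := h.continuous_u.comp continuous_snd
  continuous_e := by
    have := h.continuous_e
    exact (continuous_fst.comp continuous_fst).prodMk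
      (this.comp ((continuous_snd.comp continuous_fst).prodMk continuous_snd))
  e_zero z := by simp [h.e_zero]
  e_mem z t hz := h.e_mem _ _ hz
  u_eq_zero z hz := h.u_eq_zero _ hz
  e_fix z hz t := by simp [h.e_fix _ hz]
  u_nonneg z := h.u_nonneg _

end Extension

/-! ### Contracting attached arcs -/

section Contract

variable {X E : Type*} [TopologicalSpace X] {φ₀ φ₁ : E → X}

/-- A deformation of the attached arcs, over a set `A` which contains their ends and has a
deformation neighbourhood, extends to a deformation of the whole space. -/
theorem AttachArcs.exists_deformation {A : Set X} [DiscreteTopology A] {u : X → ℝ}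
    {r : X → I → X} (h : IsDeformationNhd A u r) (γ : A → C(I, AttachArcs φ₀ φ₁))
    (hγ : ∀ a, γ a 0 = pt φ₀ φ₁ a) (D : E → C(I × I, AttachArcs φ₀ φ₁))
    (hD : ∀ e s, D e (s, 0) = arc φ₀ φ₁ e s) (hA₀ : ∀ e, φ₀ e ∈ A) (hA₁ : ∀ e, φ₁ e ∈ A)
    (hD₀ : ∀ e t, D e (0, t) = γ ⟨φ₀ e, hA₀ e⟩ t) (hD₁ : ∀ e t, D e (1, t) = γ ⟨φ₁ e, hA₁ e⟩ t) :
    ∃ H : C(AttachArcs φ₀ φ₁, C(I, AttachArcs φ₀ φ₁)), (∀ y, H y 0 = y) ∧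
      (∀ a : A, H (pt φ₀ φ₁ a) = γ a) ∧ ∀ e s t, H (arc φ₀ φ₁ e s) t = D e (s, t) := by
  obtain ⟨G, hG₀, hG⟩ := h.exists_extension (pt φ₀ φ₁) γ hγ
  let δ : ∀ e, Path (G (φ₀ e)) (G (φ₁ e)) := fun e =>
    { toFun := (D e).curry
      continuous_toFun := (D e).curry.continuous
      source' := by
        rw [hG ⟨φ₀ e, hA₀ e⟩]
        ext t
        exact hD₀ e t
      target' := by
        rw [hG ⟨φ₁ e, hA₁ e⟩]
        ext t
        exact hD₁ e t }
  refine ⟨desc G δ, ?_, hG, fun e s t => rfl⟩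
  exact ind hG₀ fun e s => hD e s

/-- Contracting arcs that join the points `φ₀ e`, all distinct, to points of a set `C` that
contains none of them amounts to identifying the ends of each arc. -/
theorem AttachArcs.nonempty_homotopyEquiv_of_identify (hφ : Function.Injective φ₀) {C : Set X}
    (hC₁ : ∀ e, φ₁ e ∈ C) (hC₀ : ∀ e, φ₀ e ∉ C) {A : Set X} (hA : A = C ∪ Set.range φ₀)
    [DiscreteTopology A] {u : X → ℝ} {r : X → I → X} (h : IsDeformationNhd A u r)
    {Q : Type*} [TopologicalSpace Q] (f : C(X, Q)) (hf : IsQuotientMap f)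
    (hid : ∀ e, f (φ₀ e) = f (φ₁ e)) (hker : ∀ x x', f x = f x' → x = x' ∨ (x ∈ A ∧ x' ∈ A))
    (hinj : Set.InjOn f C) : Nonempty (AttachArcs φ₀ φ₁ ≃ₕ Q) := by
  classical
  let q : C(AttachArcs φ₀ φ₁, Q) := desc f fun e => (Path.refl (f (φ₀ e))).cast rfl (hid e).symm
  have hq_pt : ∀ x, q (pt φ₀ φ₁ x) = f x := fun _ => rfl
  have hq_arc : ∀ e s, q (arc φ₀ φ₁ e s) = f (φ₁ e) := fun e s => hid e
  have hq : IsQuotientMap q :=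
    IsQuotientMap.of_comp (pt φ₀ φ₁).continuous q.continuous hf
  have hA₀ : ∀ e, φ₀ e ∈ A := fun e => hA ▸ Or.inr ⟨e, rfl⟩
  have hA₁ : ∀ e, φ₁ e ∈ A := fun e => hA ▸ Or.inl (hC₁ e)
  let γ : A → C(I, AttachArcs φ₀ φ₁) := fun a =>
    if ha : ∃ e, φ₀ e = a then (arc φ₀ φ₁ ha.choose) else ContinuousMap.const I (pt φ₀ φ₁ a)
  have hγ₀ : ∀ e, γ ⟨φ₀ e, hA₀ e⟩ = arc φ₀ φ₁ e := by
    intro e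
    have ha : ∃ e', φ₀ e' = φ₀ e := ⟨e, rfl⟩
    have he : ha.choose = e := hφ ha.choose_spec
    simp only [γ, ha, dite_true]
    rw [he]
  have hγ₁ : ∀ a : A, a.1 ∈ C → γ a = ContinuousMap.const I (pt φ₀ φ₁ a) := by
    intro a haC
    have ha : ¬∃ e', φ₀ e' = a.1 := by
      rintro ⟨e', he'⟩
      exact hC₀ e' (he' ▸ haC)
    simp only [γ, ha, dite_false]
  have hAcases : ∀ a : A, a.1 ∈ C ∨ ∃ e, a = ⟨φ₀ e, hA₀ e⟩ := by
    rintro ⟨a, ha⟩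
    rw [hA] at ha
    rcases ha with ha | ⟨e, rfl⟩
    · exact Or.inl ha
    · exact Or.inr ⟨e, rfl⟩
  -- At time `t` the point at position `s` of an arc has moved to `1 - (1 - s) (1 - t)`.
  let D : E → C(I × I, AttachArcs φ₀ φ₁) := fun e =>
    (arc φ₀ φ₁ e : C(I, _)).comp ⟨fun z => σ (σ z.1 * σ z.2), by fun_prop⟩
  have hDe : ∀ e s t, D e (s, t) = arc φ₀ φ₁ e (σ (σ s * σ t)) := fun _ _ _ => rfl
  obtain ⟨H, hH₀, hHA, hHarc⟩ := exists_deformation h γ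
    (by
      intro a
      rcases hAcases a with ha | ⟨e, rfl⟩
      · rw [hγ₁ a ha]; rfl
      · rw [hγ₀]; exact (arc φ₀ φ₁ e).source)
    D (by intro e s; rw [hDe]; simp) hA₀ hA₁
    (by intro e t; rw [hDe, hγ₀]; simp)
    (by intro e t; rw [hDe, hγ₁ _ (hC₁ e)]; simp)
  -- On the arcs and on `A` the final map sends everything to the end of an arc that lies in `C`.
  have hend : ∀ y, ((∃ a : A, y = pt φ₀ φ₁ a) ∨ ∃ e s, y = arc φ₀ φ₁ e s) →
      ∃ c ∈ C, q y = f c ∧ H y 1 = pt φ₀ φ₁ c := by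
    rintro y (⟨a, rfl⟩ | ⟨e, s, rfl⟩)
    · rcases hAcases a with ha | ⟨e, rfl⟩
      · exact ⟨a, ha, rfl, by rw [hHA, hγ₁ a ha]; rfl⟩
      · exact ⟨φ₁ e, hC₁ e, hid e, by rw [hHA, hγ₀]; exact (arc φ₀ φ₁ e).target⟩
    · exact ⟨φ₁ e, hC₁ e, hq_arc e s, by rw [hHarc, hDe]; simp⟩
  refine nonempty_homotopyEquiv_of_collapse q hq H hH₀
    {y | (∃ a : A, y = pt φ₀ φ₁ a) ∨ ∃ e s, y = arc φ₀ φ₁ e s} ?_ ?_ ?_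
  · have hcover : ∀ y : AttachArcs φ₀ φ₁, (∃ x, y = pt φ₀ φ₁ x ∧ x ∉ A) ∨
        ((∃ a : A, y = pt φ₀ φ₁ a) ∨ ∃ e s, y = arc φ₀ φ₁ e s) := by
      refine ind (fun x => ?_) fun e s => Or.inr (Or.inr ⟨e, s, rfl⟩)
      by_cases hx : x ∈ A
      · exact Or.inr (Or.inl ⟨⟨x, hx⟩, rfl⟩)
      · exact Or.inl ⟨x, rfl, hx⟩
    have hmeet : ∀ x ∉ A, ∀ y, q (pt φ₀ φ₁ x) = q y → pt φ₀ φ₁ x = y := by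
      intro x hx
      refine ind (fun x' h => ?_) fun e s h => ?_
      · rcases hker x x' h with rfl | ⟨hx', -⟩
        · rfl
        · exact absurd hx' hx
      · rcases hker x (φ₀ e) h with rfl | ⟨hx', -⟩
        · exact absurd (hA₀ e) hx
        · exact absurd hx' hx
    intro y y' hyy
    rcases hcover y with ⟨x, rfl, hx⟩ | hy
    · exact Or.inl (hmeet x hx y' hyy)
    rcases hcover y' with ⟨x, rfl, hx⟩ | hy'
    · exact Or.inl (hmeet x hx y hyy.symm).symm
    exact Or.inr ⟨hy, hy'⟩
  · rintro y (⟨a, rfl⟩ | ⟨e, s, rfl⟩) t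
    · rcases hAcases a with ha | ⟨e, rfl⟩
      · rw [hHA, hγ₁ a ha]; rfl
      · rw [hHA, hγ₀]; rfl
    · rw [hHarc]; rfl
  · intro y hy y' hy' hyy
    obtain ⟨c, hc, hqc, hHc⟩ := hend y hy
    obtain ⟨c', hc', hqc', hHc'⟩ := hend y' hy'
    rw [hHc, hHc', hinj hc hc' (by rw [← hqc, ← hqc', hyy])]

end Contract

/-! ### Chains of paths -/

section Chain

/-- A chain of paths is traversed by a single map from the line, the `k`-th path being run through
between the times `k` and `k + 1`. -/
theorem exists_chain {Y : Type*} [TopologicalSpace Y] : ∀ (m : ℕ) (P : Fin (m + 1) → Y)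
    (γ : ∀ k : Fin m, Path (P k.castSucc) (P k.succ)),
    ∃ c : C(ℝ, Y), (∀ k : Fin (m + 1), c (k : ℕ) = P k) ∧
      (∀ (k : Fin m) (s : I), c ((k : ℕ) + s) = γ k s) ∧
      ∀ τ, (∃ k, c τ = P k) ∨ ∃ k s, c τ = γ k s
  | 0, P, _ =>
    ⟨ContinuousMap.const ℝ (P 0), fun k => congrArg P (Subsingleton.elim (0 : Fin 1) k),
      fun k => k.elim0, fun _ => Or.inl ⟨0, rfl⟩⟩
  | m + 1, P, γ => by
    obtain ⟨c, hc, hcγ, hcr⟩ := exists_chain m (fun k => P k.castSucc) fun k => γ k.castSucc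
    have hlast : c m = P (Fin.last m).castSucc := by simpa using hc (Fin.last m)
    let c' : ℝ → Y := fun τ =>
      if τ ≤ m then c τ else γ (Fin.last m) (Set.projIcc 0 1 zero_le_one (τ - m))
    have hc' : Continuous c' := by
      refine Continuous.if_le c.continuous ?_ continuous_id continuous_const ?_
      · exact (γ (Fin.last m)).continuous.comp (continuous_projIcc.comp (by fun_prop))
      · rintro τ rfl
        simp [hlast]
    have hcast : ∀ k : Fin (m + 1), c' (k : ℕ) = P k.castSucc := by
      intro k
      have : ((k : ℕ) : ℝ) ≤ m := by exact_mod_cast Nat.lt_succ_iff.mp k.2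
      simp [c', this, hc]
    have harc : ∀ (k : Fin (m + 1)) (s : I), c' ((k : ℕ) + s) = γ k s := by
      intro k s
      refine Fin.lastCases ?_ (fun k => ?_) k
      · by_cases hs : (s : ℝ) ≤ 0
        · have : s = 0 := le_antisymm hs s.2.1
          subst this
          simp [c', hlast]
        · have : ¬ ((m : ℝ) + s ≤ m) := by linarith
          simp [c', hs]
      · have : ((k : ℕ) : ℝ) + s ≤ m := by
          have h1 : ((k : ℕ) : ℝ) + 1 ≤ m := by exact_mod_cast k.2
          linarith [s.2.2]
        simp only [c', Fin.val_castSucc, this, if_true]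
        exact hcγ k s
    refine ⟨⟨c', hc'⟩, fun k => ?_, harc, fun τ => ?_⟩
    · refine Fin.lastCases ?_ (fun k => ?_) k
      · have := harc (Fin.last m) 1
        simpa using this
      · exact hcast k
    · by_cases hτ : τ ≤ m
      · have : c' τ = c τ := by simp [c', hτ]
        rcases hcr τ with ⟨k, hk⟩ | ⟨k, s, hk⟩
        · exact Or.inl ⟨k.castSucc, this.trans hk⟩
        · exact Or.inr ⟨k.castSucc, s, this.trans hk⟩
      · exact Or.inr ⟨Fin.last m, Set.projIcc 0 1 zero_le_one (τ - m), by simp [c', hτ]⟩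

end Chain

/-! ### The wedge of copies of a space and of circles -/

section Wedge

theorem collapse_mk_eq_mk {X : Type*} {A : Set X} {x y : X} :
    Quotient.mk (collapse A) x = Quotient.mk (collapse A) y ↔ x = y ∨ (x ∈ A ∧ y ∈ A) :=
  Quotient.eq (r := collapse A)

variable (n l : ℕ) (X : Type*) [TopologicalSpace X] (p : X)

/-- The copies of `X` in the wedge. -/
def wedgeCopy : C(Fin n × X, WedgeWithCircles n l X p) where
  toFun z := Quotient.mk _ (Sum.inl (Quotient.mk _ (Sum.inr z)))
  continuous_toFun := continuous_quotient_mk'.comp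
    (continuous_inl.comp (continuous_quotient_mk'.comp continuous_inr))

/-- The circles in the wedge. -/
def wedgeLoop : C(Fin l × Circle, WedgeWithCircles n l X p) where
  toFun z := Quotient.mk _ (Sum.inr (Quotient.mk _ (Sum.inr z)))
  continuous_toFun := continuous_quotient_mk'.comp
    (continuous_inr.comp (continuous_quotient_mk'.comp continuous_inr))

/-- The base point of the wedge. -/
def wedgeBase : WedgeWithCircles n l X p := Quotient.mk _ (Sum.inl (WedgeCopies.base n X p))

variable {n l X p}

theorem wedgeLoop_base' :
    (Quotient.mk _ (Sum.inr (WedgeCopies.base l Circle 1)) : WedgeWithCircles n l X p) =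
      wedgeBase n l X p :=
  collapse_mk_eq_mk.2 (Or.inr ⟨Or.inr rfl, Or.inl rfl⟩)

@[simp] theorem wedgeCopy_base (k : Fin n) : wedgeCopy n l X p (k, p) = wedgeBase n l X p :=
  congrArg (fun z => (Quotient.mk _ (Sum.inl z) : WedgeWithCircles n l X p))
    (collapse_mk_eq_mk.2 (Or.inr ⟨Or.inr ⟨k, rfl⟩, Or.inl rfl⟩))

@[simp] theorem wedgeLoop_base (b : Fin l) : wedgeLoop n l X p (b, 1) = wedgeBase n l X p :=
  (congrArg (fun z => (Quotient.mk _ (Sum.inr z) : WedgeWithCircles n l X p))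
    (collapse_mk_eq_mk.2 (Or.inr ⟨Or.inr ⟨b, rfl⟩, Or.inl rfl⟩))).trans wedgeLoop_base'

theorem wedge_ind {P : WedgeWithCircles n l X p → Prop} (h₀ : P (wedgeBase n l X p))
    (hc : ∀ z, P (wedgeCopy n l X p z)) (hl : ∀ z, P (wedgeLoop n l X p z)) (w) : P w := by
  induction w using Quotient.inductionOn with
  | h w =>
    rcases w with w | w
    · induction w using Quotient.inductionOn with
      | h w =>
        rcases w with ⟨⟩ | z
        · exact h₀
        · exact hc z
    · induction w using Quotient.inductionOn with
      | h w =>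
        rcases w with ⟨⟩ | z
        · have := wedgeLoop_base' (n := n) (l := l) (X := X) (p := p)
          exact this ▸ h₀
        · exact hl z

theorem copies_mk_eq_mk {z z' : Fin n × X} :
    @Eq (WedgeCopies n X p) (Quotient.mk _ (Sum.inr z)) (Quotient.mk _ (Sum.inr z')) ↔
      z = z' ∨ (z.2 = p ∧ z'.2 = p) := by
  rw [collapse_mk_eq_mk]
  refine or_congr Sum.inr_injective.eq_iff (and_congr ?_ ?_) <;>
  · constructor
    · rintro (h | ⟨k, hk⟩)
      · cases h
      · exact (congrArg Prod.snd (Sum.inr_injective hk)).symm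
    · intro h
      exact Or.inr ⟨_, congrArg Sum.inr (Prod.ext rfl h.symm)⟩

theorem copies_mk_eq_base {z : Fin n × X} :
    ((Quotient.mk _ (Sum.inr z) : WedgeCopies n X p) = WedgeCopies.base n X p) ↔ z.2 = p := by
  rw [collapse_mk_eq_mk]
  constructor
  · rintro (h | ⟨h | ⟨k, hk⟩, -⟩)
    · cases h
    · cases h
    · exact (congrArg Prod.snd (Sum.inr_injective hk)).symm
  · intro h
    exact Or.inr ⟨Or.inr ⟨_, congrArg Sum.inr (Prod.ext rfl h.symm)⟩, Or.inl rfl⟩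

theorem wedgeCopy_eq_wedgeCopy {z z' : Fin n × X}
    (h : wedgeCopy n l X p z = wedgeCopy n l X p z') : z = z' ∨ (z.2 = p ∧ z'.2 = p) := by
  rcases collapse_mk_eq_mk.1 h with h | ⟨h | h, h' | h'⟩
  · exact copies_mk_eq_mk.1 (Sum.inl_injective h)
  · exact Or.inr ⟨copies_mk_eq_base.1 (Sum.inl_injective h),
      copies_mk_eq_base.1 (Sum.inl_injective h')⟩
  · cases h'
  · cases h
  · cases h

theorem wedgeLoop_eq_wedgeLoop {z z' : Fin l × Circle}
    (h : wedgeLoop n l X p z = wedgeLoop n l X p z') : z = z' ∨ (z.2 = 1 ∧ z'.2 = 1) := by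
  rcases collapse_mk_eq_mk.1 h with h | ⟨h | h, h' | h'⟩
  · exact copies_mk_eq_mk.1 (Sum.inr_injective h)
  · cases h
  · cases h
  · cases h'
  · exact Or.inr ⟨copies_mk_eq_base.1 (Sum.inr_injective h),
      copies_mk_eq_base.1 (Sum.inr_injective h')⟩

theorem wedgeLoop_ne_wedgeCopy {z : Fin l × Circle} (hz : z.2 ≠ 1) (z' : Fin n × X) :
    wedgeLoop n l X p z ≠ wedgeCopy n l X p z' := by
  intro h
  rcases collapse_mk_eq_mk.1 h with h | ⟨h | h, -⟩
  · cases h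
  · cases h
  · exact hz (copies_mk_eq_base.1 (Sum.inr_injective h))

theorem wedgeLoop_ne_wedgeBase {z : Fin l × Circle} (hz : z.2 ≠ 1) :
    wedgeLoop n l X p z ≠ wedgeBase n l X p := by
  rw [← wedgeLoop_base' (n := n)]
  intro h
  rcases collapse_mk_eq_mk.1 h with h | ⟨h | h, -⟩
  · exact hz (copies_mk_eq_base.1 (Sum.inr_injective h))
  · cases h
  · exact hz (copies_mk_eq_base.1 (Sum.inr_injective h))

theorem wedgeCopy_eq_wedgeBase {z : Fin n × X}
    (h : wedgeCopy n l X p z = wedgeBase n l X p) : z.2 = p := by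
  rcases collapse_mk_eq_mk.1 h with h | ⟨h | h, -⟩
  · exact copies_mk_eq_base.1 (Sum.inl_injective h)
  · exact copies_mk_eq_base.1 (Sum.inl_injective h)
  · cases h

/-- A subset of the wedge is open if its traces on the copies of `X` and on the circles are. -/
theorem isOpen_wedge {U : Set (WedgeWithCircles n l X p)}
    (hc : IsOpen (wedgeCopy n l X p ⁻¹' U))
    (hl : ∀ b, IsOpen ((fun z => wedgeLoop n l X p (b, z)) ⁻¹' U)) : IsOpen U := by
  rw [← isQuotientMap_quotient_mk'.isOpen_preimage, isOpen_sum_iff]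
  constructor <;> rw [← isQuotientMap_quotient_mk'.isOpen_preimage, isOpen_sum_iff]
  · exact ⟨isOpen_discrete _, hc⟩
  · refine ⟨isOpen_discrete _, ?_⟩
    rw [← Set.ofPred_mem_eq (s := Sum.inr ⁻¹' _), ← continuous_Prop,
      continuous_prod_of_discrete_left]
    intro b
    exact continuous_Prop.2 (hl b)

/-- The closed path that runs once around the circle. -/
noncomputable def circlePath : C(I, Circle) :=
  ⟨fun s => Circle.exp (2 * Real.pi * s), by fun_prop⟩

theorem circlePath_zero : circlePath 0 = 1 := by simp [circlePath]

theorem circlePath_one : circlePath 1 = 1 := by simp [circlePath]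

theorem circlePath_injOn {s t : I} (hs : s ≠ 1) (ht : t ≠ 1) (h : circlePath s = circlePath t) :
    s = t := by
  have hπ := Real.two_pi_pos
  have key : ∀ r : I, r ≠ 1 → 2 * Real.pi * (r : ℝ) ∈ Set.Ico 0 (2 * Real.pi) := by
    intro r hr
    have : (r : ℝ) < 1 := lt_of_le_of_ne r.2.2 fun h => hr (Subtype.ext h)
    exact ⟨mul_nonneg hπ.le r.2.1, by nlinarith⟩
  have := Circle.exp_injOn_Ico (by simp) (key s hs) (key t ht) h
  exact Subtype.ext (mul_left_cancel₀ hπ.ne' this)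

theorem circlePath_ne_one {s : I} (h₀ : s ≠ 0) (h₁ : s ≠ 1) : circlePath s ≠ 1 := by
  rw [← circlePath_zero]
  exact fun h => h₀ (circlePath_injOn h₁ zero_ne_one h)

theorem isQuotientMap_circlePath : IsQuotientMap circlePath := by
  refine circlePath.continuous.isClosedMap.isQuotientMap circlePath.continuous fun z => ?_
  obtain ⟨x, rfl⟩ := Circle.exp_surjective z
  have hπ := Real.two_pi_pos
  refine ⟨⟨Int.fract (x / (2 * Real.pi)), (Int.fract_nonneg _), (Int.fract_lt_one _).le⟩, ?_⟩
  refine Circle.exp_eq_exp.2 ⟨-⌊x / (2 * Real.pi)⌋, ?_⟩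
  simp only [Int.fract]
  push_cast
  field_simp
  ring

end Wedge

/-! ### Collapsing a chain of arcs -/

section Tree

variable {X : Type*} [TopologicalSpace X]

/-- Take `m + 1` copies of `X`, join the base points of consecutive copies by arcs, and attach `l`
more arcs with ends at base points. Collapsing the chain of arcs gives the wedge of the copies
of `X` and of `l` circles. -/
theorem nonempty_homotopyEquiv_wedge [T1Space X] (p : X) {u : X → ℝ} {r : X → I → X}
    (h : IsDeformationNhd {p} u r) {m l : ℕ} (i j : Fin l → Fin (m + 1)) :
    Nonempty (AttachArcs (X := Fin (m + 1) × X)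
      (Sum.elim (fun k : Fin m => (k.castSucc, p)) fun b => (i b, p))
      (Sum.elim (fun k : Fin m => (k.succ, p)) fun b => (j b, p)) ≃ₕ
        WedgeWithCircles (m + 1) l X p) := by
  classical
  set φ₀ : Fin m ⊕ Fin l → Fin (m + 1) × X :=
    Sum.elim (fun k : Fin m => (k.castSucc, p)) fun b => (i b, p)
  set φ₁ : Fin m ⊕ Fin l → Fin (m + 1) × X :=
    Sum.elim (fun k : Fin m => (k.succ, p)) fun b => (j b, p)
  let Y := AttachArcs φ₀ φ₁
  let W := WedgeWithCircles (m + 1) l X p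
  let P : Fin (m + 1) → Y := fun k => AttachArcs.pt φ₀ φ₁ (k, p)
  let ch : ∀ k : Fin m, Path (P k.castSucc) (P k.succ) := fun k =>
    AttachArcs.arc φ₀ φ₁ (Sum.inl k)
  let ex : ∀ b : Fin l, Path (P (i b)) (P (j b)) := fun b => AttachArcs.arc φ₀ φ₁ (Sum.inr b)
  -- The quotient map to the wedge.
  let δ : ∀ e, Path (wedgeCopy (m + 1) l X p (φ₀ e)) (wedgeCopy (m + 1) l X p (φ₁ e)) := fun e =>
    match e with
    | Sum.inl k => (Path.refl (wedgeBase (m + 1) l X p)).cast (wedgeCopy_base _) (wedgeCopy_base _)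
    | Sum.inr b =>
      { toFun := fun s => wedgeLoop (m + 1) l X p (b, circlePath s)
        continuous_toFun := by fun_prop
        source' := by
          rw [circlePath_zero, wedgeLoop_base]; exact (wedgeCopy_base _).symm
        target' := by
          rw [circlePath_one, wedgeLoop_base]; exact (wedgeCopy_base _).symm }
  let q : C(Y, W) := AttachArcs.desc (wedgeCopy (m + 1) l X p) δ
  have hq_pt : ∀ z, q (AttachArcs.pt φ₀ φ₁ z) = wedgeCopy (m + 1) l X p z := fun _ => rfl
  have hq_ch : ∀ k s, q (ch k s) = wedgeBase (m + 1) l X p := fun _ _ => rfl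
  have hq_ex : ∀ b s, q (ex b s) = wedgeLoop (m + 1) l X p (b, circlePath s) := fun _ _ => rfl
  have hq_P : ∀ k, q (P k) = wedgeBase (m + 1) l X p := fun k => wedgeCopy_base k
  have hq : IsQuotientMap q := by
    refine ⟨isCoinducing_iff.2 fun U => ⟨fun hU => ?_, fun hU => hU.preimage q.continuous⟩,
      ?_⟩
    · refine isOpen_wedge (hU.preimage (AttachArcs.pt φ₀ φ₁).continuous) fun b => ?_
      rw [← isQuotientMap_circlePath.isOpen_preimage]
      exact hU.preimage (ex b).continuous
    · refine wedge_ind ⟨P 0, hq_P 0⟩ (fun z => ⟨_, hq_pt z⟩) fun z => ?_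
      obtain ⟨s, hs⟩ := isQuotientMap_circlePath.surjective z.2
      exact ⟨ex z.1 s, by rw [hq_ex, hs]⟩
  -- The chain `S` is collapsed to the base point, and nothing else is identified.
  let S : Set Y := {y | (∃ k, y = P k) ∨ ∃ k s, y = ch k s}
  have hqS : ∀ y ∈ S, q y = wedgeBase (m + 1) l X p := by
    rintro y (⟨k, rfl⟩ | ⟨k, s, rfl⟩)
    · exact hq_P k
    · exact hq_ch k s
  have hcover : ∀ y : Y, (∃ k x, y = AttachArcs.pt φ₀ φ₁ (k, x) ∧ x ≠ p) ∨
      (∃ b s, y = ex b s ∧ s ≠ 0 ∧ s ≠ 1) ∨ y ∈ S := by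
    refine AttachArcs.ind_interior (fun z => ?_) fun e s hs₀ hs₁ => ?_
    · by_cases hz : z.2 = p
      · exact Or.inr (Or.inr (Or.inl ⟨z.1, by simp only [P, ← hz]⟩))
      · exact Or.inl ⟨z.1, z.2, rfl, hz⟩
    · rcases e with k | b
      · exact Or.inr (Or.inr (Or.inr ⟨k, s, rfl⟩))
      · exact Or.inr (Or.inl ⟨b, s, rfl, hs₀, hs₁⟩)
  have hS : ∀ y y' : Y, q y = q y' → y = y' ∨ (y ∈ S ∧ y' ∈ S) := by
    intro y y' hyy
    rcases hcover y with ⟨k, x, rfl, hx⟩ | ⟨b, s, rfl, hs₀, hs₁⟩ | hy <;>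
    rcases hcover y' with ⟨k', x', rfl, hx'⟩ | ⟨b', s', rfl, hs₀', hs₁'⟩ | hy'
    · rcases wedgeCopy_eq_wedgeCopy hyy with hz | ⟨hz, -⟩
      · exact Or.inl (by rw [hz])
      · exact absurd hz hx
    · exact absurd hyy.symm (wedgeLoop_ne_wedgeCopy (circlePath_ne_one hs₀' hs₁') _)
    · exact absurd (wedgeCopy_eq_wedgeBase (hyy.trans (hqS _ hy'))) hx
    · exact absurd hyy (wedgeLoop_ne_wedgeCopy (circlePath_ne_one hs₀ hs₁) _)
    · rcases wedgeLoop_eq_wedgeLoop hyy with hz | ⟨hz, -⟩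
      · obtain ⟨rfl, hz⟩ := Prod.ext_iff.1 hz
        exact Or.inl (by rw [circlePath_injOn hs₁ hs₁' hz])
      · exact absurd hz (circlePath_ne_one hs₀ hs₁)
    · exact absurd (hyy.trans (hqS _ hy')) (wedgeLoop_ne_wedgeBase (circlePath_ne_one hs₀ hs₁))
    · exact absurd (wedgeCopy_eq_wedgeBase (hyy.symm.trans (hqS _ hy))) hx'
    · exact absurd (hyy.symm.trans (hqS _ hy))
        (wedgeLoop_ne_wedgeBase (circlePath_ne_one hs₀' hs₁'))
    · exact Or.inr ⟨hy, hy'⟩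
  -- The chain is parametrized by `c`, and contracts along itself to its first point.
  obtain ⟨c, hcP, hcch, hcS⟩ := exists_chain m P ch
  -- An additional arc is stretched along the chain at both of its ends.
  have hw : ∀ b, ∃ w : C(ℝ, Y), (∀ τ ≤ 0, w τ = c ((1 + τ) * (i b : ℕ))) ∧
      (∀ s : I, w s = ex b s) ∧ ∀ τ, 1 ≤ τ → w τ = c ((2 - τ) * (j b : ℕ)) := by
    intro b
    let w : ℝ → Y := fun τ => if τ ≤ 0 then c ((1 + τ) * (i b : ℕ)) else
      if τ ≤ 1 then ex b (Set.projIcc 0 1 zero_le_one τ) else c ((2 - τ) * (j b : ℕ))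
    have hw : Continuous w := by
      refine Continuous.if_le (by fun_prop) ?_ continuous_id continuous_const ?_
      · refine Continuous.if_le ((ex b).continuous.comp continuous_projIcc) (by fun_prop)
          continuous_id continuous_const ?_
        rintro τ rfl
        have : (2 - 1 : ℝ) = 1 := by norm_num
        simp [this, hcP]
      · rintro τ rfl
        simp [hcP]
    refine ⟨⟨w, hw⟩, fun τ hτ => by simp [w, hτ], fun s => ?_, fun τ hτ => ?_⟩
    · by_cases hs : (s : ℝ) ≤ 0
      · have : s = 0 := le_antisymm hs s.2.1
        subst this
        simp [w, hcP]
      · simp [w, hs, s.2.2]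
    · rcases hτ.eq_or_lt with rfl | hτ
      · have : (2 - 1 : ℝ) = 1 := by norm_num
        simp [w, this, hcP, not_le.2 (zero_lt_one (α := ℝ))]
      · simp [w, not_le.2 hτ, not_le.2 (zero_lt_one.trans hτ)]
  choose w hw₀ hws hw₁ using hw
  have hA : Finite {z : Fin (m + 1) × X | z.2 ∈ ({p} : Set X)} := by
    refine Set.Finite.to_subtype ((Set.finite_range fun k : Fin (m + 1) => (k, p)).subset ?_)
    rintro ⟨k, x⟩ (rfl : x = p)
    exact ⟨k, rfl⟩
  let γ : {z : Fin (m + 1) × X | z.2 ∈ ({p} : Set X)} → C(I, Y) := fun a =>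
    c.comp ⟨fun t => (1 - t) * (a.1.1 : ℕ), by fun_prop⟩
  -- At time `t` the additional arc `b` runs through `w b` on the interval `[-t, 1 + t]`.
  let D : Fin m ⊕ Fin l → C(I × I, Y) := fun e =>
    match e with
    | Sum.inl k => c.comp ⟨fun z => (1 - z.2) * ((k : ℕ) + z.1), by fun_prop⟩
    | Sum.inr b => (w b).comp ⟨fun z => z.1 * (1 + 2 * z.2) - z.2, by fun_prop⟩
  have hφ₀ : ∀ e, φ₀ e ∈ {z : Fin (m + 1) × X | z.2 ∈ ({p} : Set X)} := by rintro (k | b) <;> rfl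
  have hφ₁ : ∀ e, φ₁ e ∈ {z : Fin (m + 1) × X | z.2 ∈ ({p} : Set X)} := by rintro (k | b) <;> rfl
  obtain ⟨H, hH₀, hHA, hHarc⟩ := AttachArcs.exists_deformation (h.copies (m + 1)) γ
    (by
      rintro ⟨⟨k, x⟩, hx⟩
      obtain rfl : x = p := hx
      simp [γ, hcP, P])
    D
    (by
      rintro (k | b) s
      · exact (congrArg c (by simp)).trans (hcch k s)
      · exact (congrArg (w b) (by simp)).trans (hws b s))
    hφ₀ hφ₁
    (by
      rintro (k | b) t
      · simp [D, γ, φ₀]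
      · have : -(t : ℝ) ≤ 0 := by linarith [t.2.1]
        simp [D, γ, φ₀, hw₀ b _ this, sub_eq_add_neg])
    (by
      rintro (k | b) t
      · simp [D, γ, φ₁]
      · have h1 : (1 : ℝ) ≤ 1 * (1 + 2 * t) - t := by linarith [t.2.1]
        have h2 : (2 : ℝ) - (1 * (1 + 2 * t) - t) = 1 - t := by ring
        simp only [D, γ, φ₁, ContinuousMap.comp_apply, ContinuousMap.coe_mk, Set.Icc.coe_one,
          hw₁ b _ h1, h2, Sum.elim_inr])
  have hHS : ∀ y ∈ S, ∃ τ : ℝ, ∀ t, H y t = c ((1 - t) * τ) := by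
    rintro y (⟨k, rfl⟩ | ⟨k, s, rfl⟩)
    · exact ⟨(k : ℕ), fun t => DFunLike.congr_fun (hHA ⟨(k, p), rfl⟩) t⟩
    · exact ⟨(k : ℕ) + s, fun t => hHarc (Sum.inl k) s t⟩
  refine nonempty_homotopyEquiv_of_collapse q hq H hH₀ S hS ?_ ?_
  · intro y hy t
    obtain ⟨τ, hτ⟩ := hHS y hy
    rw [hτ, hqS y hy]
    exact hqS _ (hcS _)
  · intro y hy y' hy' _
    obtain ⟨τ, hτ⟩ := hHS y hy
    obtain ⟨τ', hτ'⟩ := hHS y' hy'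
    rw [hτ, hτ']
    simp

end Tree

/-! ### Points of a geometric realization -/

section Realization

variable {V : Type*} [Fintype V] (K : AbstractSimplicialComplex V)

theorem isCompact_realization : IsCompact (realization K) := by
  have h : realization K = ⋃ s ∈ K.faces, stdSimplex ℝ V ∩ {x | ∀ v, x v ≠ 0 → v ∈ s} := by
    ext x
    simp only [realization, Set.mem_ofPred_eq, Set.mem_iUnion, Set.mem_inter_iff, exists_prop]
    constructor
    · rintro ⟨hx, s, hs, h⟩
      exact ⟨s, hs, hx, h⟩
    · rintro ⟨s, hs, hx, h⟩
      exact ⟨hx, s, hs, h⟩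
  rw [h]
  refine (Set.toFinite K.faces).isCompact_biUnion fun s _ =>
    (isCompact_stdSimplex ℝ V).inter_right ?_
  have : {x : V → ℝ | ∀ v, x v ≠ 0 → v ∈ s} = ⋂ v ∈ {v | v ∉ s}, {x | x v = 0} := by
    ext x
    simp only [Set.mem_ofPred_eq, Set.mem_iInter]
    exact forall_congr' fun v => by tauto
  rw [this]
  exact isClosed_biInter fun v _ => isClosed_eq (continuous_apply v) continuous_const

instance : CompactSpace (realization K) :=
  isCompact_iff_compactSpace.1 (isCompact_realization K)

variable {K} in
theorem realization.sum_eq_one (x : realization K) : ∑ v, x.1 v = 1 := x.2.1.2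

variable {K} in
theorem realization.nonneg (x : realization K) (v : V) : 0 ≤ x.1 v := x.2.1.1 v

open Classical in
/-- The vertex `v` as a point of the realization. -/
noncomputable def vertexPoint (v : V) : realization K :=
  ⟨Pi.single v 1, single_mem_stdSimplex ℝ v, {v}, K.singleton_mem v, fun w hw => by
    by_contra h
    exact hw (Pi.single_eq_of_ne (by simpa using h) 1)⟩

theorem vertexPoint_self (v : V) : (vertexPoint K v).1 v = 1 := by
  classical
  exact Pi.single_eq_same v 1

theorem vertexPoint_ne {v w : V} (h : w ≠ v) : (vertexPoint K v).1 w = 0 := by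
  classical
  exact Pi.single_eq_of_ne h 1

theorem vertexPoint_injective : Function.Injective (vertexPoint K) := by
  intro v w h
  by_contra hne
  have h₁ := vertexPoint_self K v
  rw [h, vertexPoint_ne K hne] at h₁
  exact zero_ne_one h₁

variable {K} in
/-- A point whose support has at most one element is a vertex. -/
theorem exists_eq_vertexPoint (x : realization K)
    (h : ∀ v w, x.1 v ≠ 0 → x.1 w ≠ 0 → v = w) : ∃ v, x = vertexPoint K v := by
  obtain ⟨v, -, hv⟩ : ∃ v ∈ Finset.univ, x.1 v ≠ 0 := by
    refine Finset.exists_ne_zero_of_sum_ne_zero ?_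
    rw [realization.sum_eq_one x]
    exact one_ne_zero
  have hzero : ∀ w, w ≠ v → x.1 w = 0 := fun w hw => by
    by_contra hne
    exact hw (h w v hne hv)
  refine ⟨v, Subtype.ext (funext fun w => ?_)⟩
  by_cases hw : w = v
  · subst hw
    have := realization.sum_eq_one x
    rw [Finset.sum_eq_single w (fun b _ hb => hzero b hb) (by simp)] at this
    rw [this, vertexPoint_self]
  · rw [hzero w hw, vertexPoint_ne K hw]

end Realization

/-! ### Deformation neighbourhoods in a geometric realization -/

section Star

variable {V : Type*} [Fintype V] [Nonempty V]

open Classical in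
/-- For `p` and `x` in the standard simplex, the largest `m ≤ 1` for which `x - m • p` is
nonnegative. It is positive on the open star of `p` and takes the value `1` at `p` only. -/
noncomputable def starWeight (p x : V → ℝ) : ℝ :=
  Finset.univ.inf' Finset.univ_nonempty fun v => if p v = 0 then 1 else x v / p v

theorem continuous_starWeight (p : V → ℝ) : Continuous (starWeight p) := by
  classical
  refine Continuous.finset_inf'_apply _ fun v _ => ?_
  split_ifs
  · exact continuous_const
  · fun_prop

theorem starWeight_self (p : V → ℝ) : starWeight p p = 1 := by
  classical
  have h : (fun v => if p v = 0 then (1 : ℝ) else p v / p v) = fun _ => 1 := by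
    funext v
    split_ifs with h
    · rfl
    · exact div_self h
  simp [starWeight, h]

variable {p x : V → ℝ}

theorem starWeight_mul_le (hp : p ∈ stdSimplex ℝ V) (hx : x ∈ stdSimplex ℝ V) (v : V) :
    starWeight p x * p v ≤ x v := by
  classical
  by_cases h : p v = 0
  · simpa [h] using hx.1 v
  · have hpos : 0 < p v := lt_of_le_of_ne (hp.1 v) (Ne.symm h)
    rw [← le_div_iff₀ hpos]
    have := Finset.inf'_le (fun v => if p v = 0 then (1 : ℝ) else x v / p v) (Finset.mem_univ v)
    simp only [h, if_false] at this
    exact this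

theorem starWeight_nonneg (hp : p ∈ stdSimplex ℝ V) (hx : x ∈ stdSimplex ℝ V) :
    0 ≤ starWeight p x := by
  classical
  refine Finset.le_inf' _ _ fun v _ => ?_
  split_ifs
  · exact zero_le_one
  · exact div_nonneg (hx.1 v) (hp.1 v)

theorem sum_sub_starWeight (hp : p ∈ stdSimplex ℝ V) (hx : x ∈ stdSimplex ℝ V) :
    ∑ v, (x v - starWeight p x * p v) = 1 - starWeight p x := by
  rw [Finset.sum_sub_distrib, ← Finset.mul_sum, hp.2, hx.2, mul_one]

theorem starWeight_le_one (hp : p ∈ stdSimplex ℝ V) (hx : x ∈ stdSimplex ℝ V) :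
    starWeight p x ≤ 1 := by
  have h := sum_sub_starWeight hp hx
  have : 0 ≤ ∑ v, (x v - starWeight p x * p v) :=
    Finset.sum_nonneg fun v _ => sub_nonneg.2 (starWeight_mul_le hp hx v)
  linarith

/-- What is left at time `t` of the part `x - m • p` of `x`, when `x` moves towards `p`: each
coordinate decreases at unit speed, during a time that vanishes unless `x` is near `p`. -/
noncomputable def starRemainder (p x : V → ℝ) (t : ℝ) (v : V) : ℝ :=
  max (x v - starWeight p x * p v - min t (max (2 * starWeight p x - 1) 0)) 0

/-- The deformation that moves the points near `p` to `p`. -/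
noncomputable def starPush (p x : V → ℝ) (t : ℝ) (v : V) : ℝ :=
  (1 - ∑ w, starRemainder p x t w) * p v + starRemainder p x t v

theorem continuous_starRemainder (p : V → ℝ) (v : V) :
    Continuous fun z : (V → ℝ) × ℝ => starRemainder p z.1 z.2 v := by
  have h : Continuous fun z : (V → ℝ) × ℝ => starWeight p z.1 :=
    (continuous_starWeight p).comp continuous_fst
  unfold starRemainder
  fun_prop

theorem continuous_starPush (p : V → ℝ) :
    Continuous fun z : (V → ℝ) × ℝ => starPush p z.1 z.2 := by
  have h := continuous_starRemainder p
  refine continuous_pi fun v => ?_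
  unfold starPush
  exact ((continuous_const.sub (continuous_finsetSum _ fun w _ => h w)).mul
    continuous_const).add (h v)

theorem starRemainder_eq_of_min_eq_zero (hp : p ∈ stdSimplex ℝ V) (hx : x ∈ stdSimplex ℝ V)
    {t : ℝ} (h : min t (max (2 * starWeight p x - 1) 0) = 0) (v : V) :
    starRemainder p x t v = x v - starWeight p x * p v := by
  rw [starRemainder, h, sub_zero]
  exact max_eq_left (sub_nonneg.2 (starWeight_mul_le hp hx v))

theorem starPush_eq_of_min_eq_zero (hp : p ∈ stdSimplex ℝ V) (hx : x ∈ stdSimplex ℝ V)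
    {t : ℝ} (h : min t (max (2 * starWeight p x - 1) 0) = 0) : starPush p x t = x := by
  funext v
  simp only [starPush, starRemainder_eq_of_min_eq_zero hp hx h, sum_sub_starWeight hp hx]
  ring

theorem starPush_zero (hp : p ∈ stdSimplex ℝ V) (hx : x ∈ stdSimplex ℝ V) :
    starPush p x 0 = x :=
  starPush_eq_of_min_eq_zero hp hx (min_eq_left (le_max_right _ _))

theorem starPush_of_starWeight_le (hp : p ∈ stdSimplex ℝ V) (hx : x ∈ stdSimplex ℝ V) {t : ℝ}
    (ht : 0 ≤ t) (h : starWeight p x ≤ 1 / 2) : starPush p x t = x := by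
  refine starPush_eq_of_min_eq_zero hp hx ?_
  rw [max_eq_right (by linarith), min_eq_right ht]

theorem starPush_eq_self (hp : p ∈ stdSimplex ℝ V) (hx : x ∈ stdSimplex ℝ V) {t : ℝ}
    (ht : 4 * (1 - starWeight p x) ≤ t) (ht₁ : t ≤ 1) : starPush p x t = p := by
  have hm := starWeight_le_one hp hx
  have hzero : ∀ v, starRemainder p x t v = 0 := by
    intro v
    refine max_eq_right ?_
    have h₁ : x v - starWeight p x * p v ≤ 1 - starWeight p x := by
      rw [← sum_sub_starWeight hp hx]
      exact Finset.single_le_sum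
        (fun w _ => sub_nonneg.2 (starWeight_mul_le hp hx w)) (Finset.mem_univ v)
    have h₂ : 1 - starWeight p x ≤ min t (max (2 * starWeight p x - 1) 0) :=
      le_min (by linarith) (le_max_of_le_left (by linarith))
    linarith
  funext v
  simp [starPush, hzero]

theorem starPush_mem_stdSimplex (hp : p ∈ stdSimplex ℝ V) (hx : x ∈ stdSimplex ℝ V) {t : ℝ}
    (ht : 0 ≤ t) : starPush p x t ∈ stdSimplex ℝ V := by
  have h₀ : ∀ v, 0 ≤ starRemainder p x t v := fun v => le_max_right _ _
  have h₁ : ∀ v, starRemainder p x t v ≤ x v - starWeight p x * p v := fun v =>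
    max_le (by
      have : 0 ≤ min t (max (2 * starWeight p x - 1) 0) := le_min ht (le_max_right _ _)
      linarith) (sub_nonneg.2 (starWeight_mul_le hp hx v))
  have h₂ : ∑ w, starRemainder p x t w ≤ 1 - starWeight p x := by
    rw [← sum_sub_starWeight hp hx]
    exact Finset.sum_le_sum fun v _ => h₁ v
  have h₃ := starWeight_nonneg hp hx
  refine ⟨fun v => add_nonneg (mul_nonneg (by linarith) (hp.1 v)) (h₀ v), ?_⟩
  simp only [starPush]
  rw [Finset.sum_add_distrib, ← Finset.mul_sum, hp.2]
  ring

theorem starPush_ne_zero (hp : p ∈ stdSimplex ℝ V) (hx : x ∈ stdSimplex ℝ V) {t : ℝ}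
    (ht : 0 ≤ t) {v : V} (h : starPush p x t v ≠ 0) : x v ≠ 0 := by
  by_cases hm : starWeight p x ≤ 1 / 2
  · rwa [starPush_of_starWeight_le hp hx ht hm] at h
  · intro hxv
    have h₁ := starWeight_mul_le hp hx v
    have hpv : p v = 0 := by
      have := hp.1 v
      have hm' : 0 < starWeight p x := by linarith
      rw [hxv] at h₁
      nlinarith
    apply h
    have h₂ : 0 ≤ min t (max (2 * starWeight p x - 1) 0) := le_min ht (le_max_right _ _)
    simp [starPush, starRemainder, hpv, hxv, h₂]

variable {K : AbstractSimplicialComplex V}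

theorem starPush_mem_realization (p x : realization K) (t : I) :
    starPush p.1 x.1 t ∈ realization K := by
  obtain ⟨s, hs, hsx⟩ := x.2.2
  exact ⟨starPush_mem_stdSimplex p.2.1 x.2.1 t.2.1, s, hs,
    fun v hv => hsx v (starPush_ne_zero p.2.1 x.2.1 t.2.1 hv)⟩

theorem continuous_starPush_realization (p : realization K) :
    Continuous fun z : realization K × I => starPush p.1 z.1.1 z.2 := by
  have hz : Continuous fun z : realization K × I => ((z.1.1, (z.2 : ℝ)) : (V → ℝ) × ℝ) := by
    fun_prop
  exact (continuous_starPush p.1).comp hz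

/-- Finitely many points of a realization have a deformation neighbourhood, as soon as the
regions in which the deformations towards them take place are disjoint. -/
theorem exists_isDeformationNhd {ι : Type*} [Finite ι] [Nonempty ι] (P : ι → realization K)
    (hP : ∀ (x : realization K) i j, 1 / 2 < starWeight (P i).1 x.1 →
      1 / 2 < starWeight (P j).1 x.1 → i = j) :
    ∃ u r, IsDeformationNhd (Set.range P) u r := by
  classical
  cases nonempty_fintype ι
  -- At most one of the displacements in the sum is nonzero at a given `x`.
  let d : realization K → I → V → ℝ := fun x t => x.1 + ∑ i, (starPush (P i).1 x.1 t - x.1)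
  have hd₁ : ∀ x t i, 1 / 2 < starWeight (P i).1 x.1 → d x t = starPush (P i).1 x.1 t := by
    intro x t i hi
    have : ∑ j, (starPush (P j).1 x.1 t - x.1) = starPush (P i).1 x.1 t - x.1 := by
      refine Finset.sum_eq_single i (fun j _ hj => ?_) (by simp)
      rw [starPush_of_starWeight_le (P j).2.1 x.2.1 t.2.1, sub_self]
      by_contra h
      exact hj (hP x j i (not_le.1 h) hi)
    simp only [d, this, add_sub_cancel]
  have hd₂ : ∀ x t, (∀ i, starWeight (P i).1 x.1 ≤ 1 / 2) → d x t = x.1 := by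
    intro x t h
    have : ∑ j, (starPush (P j).1 x.1 t - x.1) = 0 := by
      refine Finset.sum_eq_zero fun j _ => ?_
      rw [starPush_of_starWeight_le (P j).2.1 x.2.1 t.2.1 (h j), sub_self]
    simp only [d, this, add_zero]
  have hdK : ∀ x t, d x t ∈ realization K := by
    intro x t
    by_cases h : ∀ i, starWeight (P i).1 x.1 ≤ 1 / 2
    · rw [hd₂ x t h]; exact x.2
    · obtain ⟨i, hi⟩ := not_forall.1 h
      rw [hd₁ x t i (not_le.1 hi)]
      exact starPush_mem_realization _ _ _
  have hd_zero : ∀ x, d x 0 = x.1 := by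
    intro x
    have : ∑ j, (starPush (P j).1 x.1 (0 : I) - x.1) = 0 := by
      refine Finset.sum_eq_zero fun j _ => ?_
      rw [Set.Icc.coe_zero, starPush_zero (P j).2.1 x.2.1, sub_self]
    simp only [d, this, add_zero]
  let u : realization K → ℝ := fun x =>
    Finset.univ.inf' Finset.univ_nonempty fun i => 4 * (1 - starWeight (P i).1 x.1)
  have hu₀ : ∀ x, 0 ≤ u x := fun x => Finset.le_inf' _ _ fun i _ => by
    have := starWeight_le_one (P i).2.1 x.2.1
    linarith
  have hd_end : ∀ x i (t : I), 4 * (1 - starWeight (P i).1 x.1) ≤ t → d x t = (P i).1 := by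
    intro x i t ht
    have := t.2.2
    rw [hd₁ x t i (by linarith)]
    exact starPush_eq_self (P i).2.1 x.2.1 ht this
  refine ⟨u, fun x t => ⟨d x t, hdK x t⟩, ?_, ?_, ?_, ?_, ?_, ?_, hu₀⟩
  · refine Continuous.finset_inf'_apply _ fun i _ => ?_
    have := continuous_starWeight (P i).1
    fun_prop
  · refine Continuous.subtype_mk ?_ _
    have hx : Continuous fun z : realization K × I => z.1.1 :=
      continuous_subtype_val.comp continuous_fst
    exact Continuous.add hx
      (continuous_finsetSum Finset.univ fun i _ => (continuous_starPush_realization (P i)).sub hx)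
  · exact fun x => Subtype.ext (hd_zero x)
  · intro x t ht
    obtain ⟨i, -, hi⟩ := Finset.exists_mem_eq_inf' (Finset.univ_nonempty (α := ι))
      fun i => 4 * (1 - starWeight (P i).1 x.1)
    have hi' : u x = 4 * (1 - starWeight (P i).1 x.1) := hi
    exact ⟨i, Subtype.ext (hd_end x i t (hi'.symm.le.trans ht)).symm⟩
  · rintro _ ⟨i, rfl⟩
    refine le_antisymm ?_ (hu₀ _)
    refine (Finset.inf'_le _ (Finset.mem_univ i)).trans ?_
    rw [starWeight_self]
    norm_num
  · rintro _ ⟨i, rfl⟩ t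
    refine Subtype.ext (hd_end (P i) i t ?_)
    rw [starWeight_self]
    simpa using t.2.1

theorem exists_isDeformationNhd_singleton (p : realization K) :
    ∃ u r, IsDeformationNhd {p} u r := by
  obtain ⟨u, r, h⟩ := exists_isDeformationNhd (fun _ : Unit => p) fun _ _ _ _ _ => rfl
  rw [Set.range_const] at h
  exact ⟨u, r, h⟩

theorem exists_isDeformationNhd_vertices :
    ∃ u r, IsDeformationNhd (Set.range (vertexPoint K)) u r := by
  refine exists_isDeformationNhd _ fun x v w hv hw => ?_
  by_contra hne
  have key : ∀ v, starWeight (vertexPoint K v).1 x.1 ≤ x.1 v := by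
    intro v
    have := starWeight_mul_le (vertexPoint K v).2.1 x.2.1 v
    rwa [vertexPoint_self, mul_one] at this
  have h := Finset.add_le_sum (fun i _ => realization.nonneg x i) (Finset.mem_univ v)
    (Finset.mem_univ w) hne
  rw [realization.sum_eq_one] at h
  linarith [key v, key w]

end Star

/-- A connected space in which each point has a deformation neighbourhood is path-connected. -/
theorem joined_of_isDeformationNhd {X : Type*} [TopologicalSpace X] [PreconnectedSpace X]
    (h : ∀ p : X, ∃ u r, IsDeformationNhd {p} u r) (x y : X) : Joined x y := by
  have hnhd : ∀ p : X, ∀ᶠ z in 𝓝 p, Joined z p := by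
    intro p
    obtain ⟨u, r, hr⟩ := h p
    have : ∀ᶠ z in 𝓝 p, u z < 1 := by
      refine (hr.continuous_u.tendsto p).eventually_lt_const ?_
      rw [hr.u_eq_zero p rfl]
      exact zero_lt_one
    filter_upwards [this] with z hz
    exact ⟨{
      toFun := r z
      continuous_toFun := hr.continuous_e.comp (continuous_const.prodMk continuous_id)
      source' := hr.e_zero z
      target' := hr.e_mem z 1 hz.le }⟩
  have hclopen : IsClopen {z | Joined x z} := by
    refine ⟨⟨isOpen_iff_mem_nhds.2 fun z hz => ?_⟩, isOpen_iff_mem_nhds.2 fun z hz => ?_⟩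
    · filter_upwards [hnhd z] with z' hz' hx
      exact hz (hx.trans hz')
    · filter_upwards [hnhd z] with z' hz'
      exact hz.trans hz'.symm
  exact Set.eq_univ_iff_forall.1 (hclopen.eq_univ ⟨x, Joined.refl x⟩) y

/-! ### Golomb rulers -/

section Ruler

theorem two_pow_add_two_pow : ∀ {i j k l : ℕ}, 2 ^ i + 2 ^ j = 2 ^ k + 2 ^ l → i = k ∨ i = l
  | 0, _, 0, _, _ => Or.inl rfl
  | 0, _, _ + 1, 0, _ => Or.inr rfl
  | 0, 0, k + 1, l + 1, h => by
    have := Nat.one_le_two_pow (n := k)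
    have := Nat.one_le_two_pow (n := l)
    rw [pow_succ, pow_succ] at h
    omega
  | 0, j + 1, k + 1, l + 1, h => by
    rw [pow_succ, pow_succ, pow_succ] at h
    omega
  | i + 1, j, 0, 0, h => by
    have := Nat.one_le_two_pow (n := i)
    have := Nat.one_le_two_pow (n := j)
    rw [pow_succ] at h
    omega
  | i + 1, 0, 0, l + 1, h => Or.inr (Nat.pow_right_injective le_rfl
      (show 2 ^ (i + 1) = 2 ^ (l + 1) by omega))
  | i + 1, j + 1, 0, l + 1, h => by
    rw [pow_succ, pow_succ, pow_succ] at h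
    omega
  | i + 1, 0, k + 1, 0, h => Or.inl (Nat.pow_right_injective le_rfl
      (show 2 ^ (i + 1) = 2 ^ (k + 1) by omega))
  | i + 1, j + 1, k + 1, 0, h => by
    rw [pow_succ, pow_succ, pow_succ] at h
    omega
  | i + 1, 0, k + 1, l + 1, h => by
    rw [pow_succ, pow_succ, pow_succ] at h
    omega
  | i + 1, j + 1, k + 1, l + 1, h => by
    have := @two_pow_add_two_pow i j k l (by
      rw [pow_succ, pow_succ, pow_succ, pow_succ] at h
      omega)
    omega

variable {V : Type*}

/-- The powers of `2` form a ruler, and any large prime is admissible for it. -/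
theorem exists_isGolombRuler_isAdmissibleModulus [Finite V] :
    ∃ (a : V → ℕ) (n : ℕ), n ≠ 0 ∧ IsGolombRuler a ∧ IsAdmissibleModulus a n := by
  rcases subsingleton_or_nontrivial V with hV | hV
  · exact ⟨fun _ => 0, 1, one_ne_zero,
      ⟨Function.injective_of_subsingleton _, fun i j _ _ _ => Or.inl (Subsingleton.elim i j)⟩,
      fun _ => by simp, fun _ _ h => by simp at h, fun _ => rfl⟩
  · let e := Finite.equivFin V
    let a : V → ℕ := fun v => 2 ^ (e v : ℕ)
    have ha : Function.Injective a := fun v w h =>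
      e.injective (Fin.ext (Nat.pow_right_injective le_rfl h))
    obtain ⟨n, hn, hprime⟩ := Nat.exists_infinite_primes (2 * 2 ^ Nat.card V + 1)
    have hlt : ∀ v, 2 * a v < n := fun v => by
      have : a v ≤ 2 ^ Nat.card V := Nat.pow_le_pow_right two_pos (e v).2.le
      omega
    refine ⟨a, n, hprime.ne_zero, ⟨ha, fun i j i' j' h => ?_⟩, hlt, fun v w h => ?_, fun h => ?_⟩
    · have h' : 2 ^ (e j : ℕ) + 2 ^ (e i' : ℕ) = 2 ^ (e i : ℕ) + 2 ^ (e j' : ℕ) := by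
        have : ((a j + a i' : ℕ) : ℤ) = (a i + a j' : ℕ) := by push_cast; linarith
        exact_mod_cast this
      rcases two_pow_add_two_pow h' with h | h
      · exact Or.inl (e.injective (Fin.ext h)).symm
      · exact Or.inr (e.injective (Fin.ext h))
    · have := hlt w
      have h₀ : a w - a v ≠ 0 := by omega
      have h₁ : a w - a v < n := by omega
      exact Nat.coprime_of_lt_prime h₀ h₁ hprime
    · exact absurd h (not_subsingleton V)

variable {a : V → ℕ} {n : ℕ}

/-- The defining property of a ruler persists modulo an admissible `n`. -/
theorem IsGolombRuler.zmod (ha : IsGolombRuler a) (hn : IsAdmissibleModulus a n) {i j i' j' : V}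
    (h : (a j : ZMod n) - a i = a j' - a i') : i = j ∨ j = j' := by
  refine ha.2 i j i' j' ?_
  have h' : (((a j : ℤ) - a i : ℤ) : ZMod n) = (((a j' : ℤ) - a i' : ℤ) : ZMod n) := by
    push_cast
    exact h
  rw [ZMod.intCast_eq_intCast_iff_dvd_sub] at h'
  have hlt := hn.1
  have h₁ := hlt i
  have h₂ := hlt j
  have h₃ := hlt i'
  have h₄ := hlt j'
  have := Int.eq_zero_of_abs_lt_dvd h' (by rw [abs_lt]; constructor <;> omega)
  omega

theorem IsGolombRuler.injective_zmod (ha : IsGolombRuler a) (hn : IsAdmissibleModulus a n) :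
    Function.Injective fun v => (a v : ZMod n) := by
  intro v w h
  have h₁ := (ZMod.natCast_eq_natCast_iff' _ _ _).1 h
  have h₂ := hn.1 v
  have h₃ := hn.1 w
  rw [Nat.mod_eq_of_lt (by omega), Nat.mod_eq_of_lt (by omega)] at h₁
  exact ha.1 h₁

/-- The residues modulo `n` can be arranged in a sequence such that the translates of the ruler by
consecutive residues meet: the steps are multiples of one difference of marks. -/
theorem exists_chain_order {m : ℕ} (ha : Function.Injective a)
    (hn : IsAdmissibleModulus a (m + 1)) (v₀ : V) :
    ∃ θ : Fin (m + 1) ≃ ZMod (m + 1), ∀ k : Fin m, ∃ v, v ≠ v₀ ∧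
      θ k.succ = θ k.castSucc + a v - a v₀ := by
  rcases subsingleton_or_nontrivial V with hV | hV
  · obtain rfl : m = 0 := by simpa using hn.2.2 hV
    exact ⟨Equiv.refl _, fun k => k.elim0⟩
  · obtain ⟨v, hv⟩ := exists_ne v₀
    have hunit : IsUnit ((a v : ZMod (m + 1)) - a v₀) := by
      rcases lt_or_gt_of_ne (fun h => hv (ha h) : a v ≠ a v₀) with h | h
      · have := (ZMod.isUnit_iff_coprime _ _).2 (hn.2.1 v v₀ h).symm
        rw [Nat.cast_sub h.le] at this
        simpa using this.neg
      · have := (ZMod.isUnit_iff_coprime _ _).2 (hn.2.1 v₀ v h).symm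
        rwa [Nat.cast_sub h.le] at this
    let θ : Fin (m + 1) → ZMod (m + 1) := fun k => (k : ℕ) * ((a v : ZMod (m + 1)) - a v₀)
    have hθ : Function.Injective θ := by
      intro k k' h
      have h₁ := (ZMod.natCast_eq_natCast_iff' _ _ _).1 (hunit.mul_right_cancel h)
      rw [Nat.mod_eq_of_lt k.2, Nat.mod_eq_of_lt k'.2] at h₁
      exact Fin.ext h₁
    have hθ' : Function.Bijective θ := (Fintype.bijective_iff_injective_and_card θ).2
      ⟨hθ, by rw [Fintype.card_fin, ZMod.card]⟩
    refine ⟨Equiv.ofBijective θ hθ', fun k => ⟨v, hv, ?_⟩⟩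
    simp only [Equiv.ofBijective_apply, θ, Fin.val_succ, Fin.val_castSucc]
    push_cast
    ring

end Ruler

/-! ### The complex as a union of translates -/

section Translate

variable {V : Type*}

/-- The translations make the complex vertex-transitive. -/
theorem isVertexTransitive_cyclicComplex [Nonempty V] (K : AbstractSimplicialComplex V)
    (a : V → ℕ) (n : ℕ) :
    IsVertexTransitive (Multiplicative (ZMod n)) (cyclicComplex K a n) := by
  classical
  let φ : Multiplicative (ZMod n) →* Equiv.Perm (ZMod n) :=
    { toFun := fun x => Equiv.addLeft x.toAdd
      map_one' := by ext; simp
      map_mul' := fun x y => by ext; simp }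
  have hφ : ∀ x y, φ x y = x.toAdd + y := fun _ _ => rfl
  have hinj : Function.Injective φ := by
    intro x y h
    have := DFunLike.congr_fun h 0
    simpa [hφ] using this
  have hmap : ∀ x (s : Finset (ZMod n)), s ∈ (cyclicComplex K a n).faces →
      s.map (φ x).toEmbedding ∈ (cyclicComplex K a n).faces := by
    rintro x _ ⟨y, s, hs, rfl⟩
    refine ⟨x.toAdd + y, s, hs, ?_⟩
    rw [Finset.map_eq_image, Finset.image_image]
    refine Finset.image_congr fun v _ => ?_
    simp [hφ, add_assoc]
  refine ⟨φ.range, ?_, ⟨MonoidHom.ofInjective hinj⟩, fun v w =>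
    ⟨φ (Multiplicative.ofAdd (w - v)), ⟨_, rfl⟩, sub_add_cancel w v⟩⟩
  rintro _ ⟨x, rfl⟩ s
  refine ⟨fun h => ?_, hmap x s⟩
  have := hmap x⁻¹ _ h
  rw [Finset.map_map] at this
  convert this
  ext y
  simp

variable [Fintype V] (a : V → ℕ) {n : ℕ}

/-- The point of the realization of the cyclic complex that corresponds to the point `y` of the
translate of `K` by `x`. -/
noncomputable def translate (x : ZMod n) (y : V → ℝ) (b : ZMod n) : ℝ :=
  ∑ v, if x + (a v : ZMod n) = b then y v else 0

theorem continuous_translate (x : ZMod n) : Continuous (translate a x) := by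
  refine continuous_pi fun b => continuous_finsetSum _ fun v _ => ?_
  split_ifs <;> fun_prop

variable {a}

theorem exists_of_translate_ne_zero {x : ZMod n} {y : V → ℝ} {b : ZMod n}
    (h : translate a x y b ≠ 0) : ∃ v, y v ≠ 0 ∧ x + (a v : ZMod n) = b := by
  obtain ⟨v, -, hv⟩ := Finset.exists_ne_zero_of_sum_ne_zero h
  by_cases hb : x + (a v : ZMod n) = b
  · exact ⟨v, by simpa [hb] using hv, hb⟩
  · simp [hb] at hv

theorem translate_apply (hinj : Function.Injective fun v => (a v : ZMod n)) (x : ZMod n)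
    (y : V → ℝ) (v : V) : translate a x y (x + a v) = y v := by
  simp only [translate]
  rw [Finset.sum_eq_single v]
  · simp
  · intro w _ hw
    rw [if_neg]
    exact fun h => hw (hinj (add_left_cancel h))
  · simp

variable {K : AbstractSimplicialComplex V}

/-- Distinct translates meet in vertices only. -/
theorem exists_vertex_of_translate_eq (ha : IsGolombRuler a) (hn : IsAdmissibleModulus a n)
    {x x' : ZMod n} (hx : x ≠ x') {y y' : realization K}
    (h : translate a x y.1 = translate a x' y'.1) : ∃ v, y = vertexPoint K v := by
  have hinj := ha.injective_zmod hn
  have key : ∀ v, y.1 v ≠ 0 → ∃ w, x' + (a w : ZMod n) = x + a v := fun v hv => by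
    rw [← translate_apply hinj x y.1 v, h] at hv
    obtain ⟨w, -, hw⟩ := exists_of_translate_ne_zero hv
    exact ⟨w, hw⟩
  refine exists_eq_vertexPoint y fun v w hv hw => ?_
  obtain ⟨v', hv'⟩ := key v hv
  obtain ⟨w', hw'⟩ := key w hw
  rcases ha.zmod hn (i := w) (j := v) (i' := w') (j' := v')
    (by linear_combination hw' - hv') with h | rfl
  · exact h.symm
  · exact absurd (add_right_cancel hv').symm hx

variable [Nonempty V] [NeZero n]

theorem translate_mem (x : ZMod n) (y : realization K) :
    translate a x y.1 ∈ realization (cyclicComplex K a n) := by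
  classical
  obtain ⟨s, hs, hsy⟩ := y.2.2
  refine ⟨⟨fun b => Finset.sum_nonneg fun v _ => ?_, ?_⟩, _, ⟨x, s, hs, rfl⟩, fun b hb => ?_⟩
  · split_ifs
    · exact realization.nonneg y v
    · exact le_rfl
  · simp only [translate]
    rw [Finset.sum_comm]
    simp [realization.sum_eq_one]
  · obtain ⟨v, hv, rfl⟩ := exists_of_translate_ne_zero hb
    exact Finset.mem_image_of_mem _ (hsy v hv)

theorem translate_vertexPoint (x : ZMod n) (v : V) :
    translate a x (vertexPoint K v).1 = (vertexPoint (cyclicComplex K a n) (x + a v)).1 := by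
  funext b
  simp only [translate]
  rw [Finset.sum_eq_single v]
  · by_cases hb : x + (a v : ZMod n) = b
    · rw [if_pos hb, vertexPoint_self, hb, vertexPoint_self]
    · rw [if_neg hb, vertexPoint_ne _ (Ne.symm hb)]
  · intro w _ hw
    rw [vertexPoint_ne K hw, ite_self]
  · simp

theorem exists_translate_eq (hinj : Function.Injective fun v => (a v : ZMod n))
    (z : realization (cyclicComplex K a n)) :
    ∃ (x : ZMod n) (y : realization K), translate a x y.1 = z.1 := by
  classical
  obtain ⟨_, ⟨x, s, hs, rfl⟩, hz⟩ := z.2.2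
  have hz' : ∀ b, z.1 b ≠ 0 → ∃ v, v ∈ s ∧ x + (a v : ZMod n) = b := fun b hb => by
    simpa using hz b hb
  let y : V → ℝ := fun v => z.1 (x + a v)
  have hyz : translate a x y = z.1 := by
    funext b
    by_cases hb : ∃ v, x + (a v : ZMod n) = b
    · obtain ⟨v, rfl⟩ := hb
      rw [translate_apply hinj]
    · have h₁ : translate a x y b = 0 := by
        by_contra h
        obtain ⟨v, -, hv⟩ := exists_of_translate_ne_zero h
        exact hb ⟨v, hv⟩
      have h₂ : z.1 b = 0 := by
        by_contra h
        obtain ⟨v, -, hv⟩ := hz' b h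
        exact hb ⟨v, hv⟩
      rw [h₁, h₂]
  have hsum : ∑ v, y v = 1 := by
    rw [← realization.sum_eq_one z, ← hyz]
    simp only [translate]
    rw [Finset.sum_comm]
    simp
  refine ⟨x, ⟨y, ⟨fun v => realization.nonneg z _, hsum⟩, s, hs, fun v hv => ?_⟩, hyz⟩
  obtain ⟨w, hw, hwv⟩ := hz' _ hv
  rwa [← hinj (add_left_cancel hwv)]

end Translate

/-! ### The homotopy type -/

section HomotopyType

variable {V : Type*} [Fintype V] [Nonempty V]

/-- An injection of `Fin m` into a finite type extends to an enumeration of the type. -/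
theorem exists_equiv_fin_sum_fin {E : Type*} [Finite E] {m : ℕ} {τ : Fin m → E}
    (hτ : Function.Injective τ) : ∃ (l : ℕ) (ε : Fin m ⊕ Fin l ≃ E), ∀ k, ε (Sum.inl k) = τ k := by
  classical
  refine ⟨_, (Equiv.sumCongr (Equiv.ofInjective τ hτ)
    (Finite.equivFin ((Set.range τ)ᶜ : Set E)).symm).trans (Equiv.Set.sumCompl _), fun k => ?_⟩
  exact Equiv.Set.sumCompl_apply_inl _ _

/-- The homotopy type of the cyclic complex. The disjoint union of the translates of `K`, with an
arc attached for each identification of two vertices, is compared with both sides. -/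
theorem exists_homotopyEquiv_wedge (K : AbstractSimplicialComplex V)
    (hK : IsConnected (realization K)) {a : V → ℕ} {n : ℕ} [NeZero n] (ha : IsGolombRuler a)
    (hn : IsAdmissibleModulus a n) :
    ∃ l : ℕ, ∀ p : realization K,
      Nonempty (realization (cyclicComplex K a n) ≃ₕ WedgeWithCircles n l (realization K) p) := by
  classical
  obtain ⟨m, rfl⟩ := Nat.exists_eq_succ_of_ne_zero (NeZero.ne n)
  have hinj := ha.injective_zmod hn
  let v₀ : V := Classical.arbitrary V
  obtain ⟨θ, hθ⟩ := exists_chain_order ha.1 hn v₀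
  choose v₁ hv₁ hθ using hθ
  -- An arc for each vertex `v ≠ v₀` of each translate, which leads to the translate in which the
  -- same vertex of the cyclic complex comes from `v₀`.
  have hτ : Function.Injective fun k : Fin m =>
      ((θ k.castSucc, ⟨v₁ k, hv₁ k⟩) : ZMod (m + 1) × {v // v ≠ v₀}) := fun k k' h =>
    Fin.castSucc_injective _ (θ.injective (congrArg Prod.fst h))
  obtain ⟨l, ε, hε⟩ := exists_equiv_fin_sum_fin hτ
  refine ⟨l, fun p => ?_⟩
  let i : Fin m ⊕ Fin l → Fin (m + 1) := fun e => θ.symm (ε e).1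
  let j : Fin m ⊕ Fin l → Fin (m + 1) := fun e => θ.symm ((ε e).1 + a (ε e).2 - a v₀)
  let φ₀ : Fin m ⊕ Fin l → Fin (m + 1) × realization K := fun e =>
    (i e, vertexPoint K (ε e).2)
  let φ₁ : Fin m ⊕ Fin l → Fin (m + 1) × realization K := fun e => (j e, vertexPoint K v₀)
  have hjoin : ∀ (k : Fin (m + 1)) (x y : realization K), Joined (k, x) (k, y) := by
    intro k x y
    have : PreconnectedSpace (realization K) := isPreconnected_iff_preconnectedSpace.1 hK.2
    obtain ⟨γ⟩ := joined_of_isDeformationNhd exists_isDeformationNhd_singleton x y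
    exact ⟨γ.map (f := fun x => (k, x)) (by fun_prop)⟩
  -- Sliding all the ends to `p` gives the arcs of the wedge.
  obtain ⟨E₁⟩ := AttachArcs.nonempty_homotopyEquiv_of_joined
    (φ₀ := φ₀) (φ₁ := φ₁) (ψ₀ := fun e => (i e, p)) (ψ₁ := fun e => (j e, p))
    (fun e => hjoin _ _ _) (fun e => hjoin _ _ _)
  have hi : (fun e => (i e, p)) = Sum.elim (fun k : Fin m => (k.castSucc, p))
      fun b => (i (Sum.inr b), p) := by
    funext e
    rcases e with k | b
    · simp [i, hε]
    · rfl
  have hj : (fun e => (j e, p)) = Sum.elim (fun k : Fin m => (k.succ, p))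
      fun b => (j (Sum.inr b), p) := by
    funext e
    rcases e with k | b
    · simp [j, hε, ← hθ]
    · rfl
  rw [hi, hj] at E₁
  obtain ⟨u, r, hr⟩ := exists_isDeformationNhd_singleton p
  obtain ⟨E₂⟩ := nonempty_homotopyEquiv_wedge p hr (m := m)
    (fun b => i (Sum.inr b)) fun b => j (Sum.inr b)
  -- Contracting the arcs identifies the vertices of the translates as in the cyclic complex.
  obtain ⟨u', r', hr'⟩ := exists_isDeformationNhd_vertices (K := K)
  let f : C(Fin (m + 1) × realization K, realization (cyclicComplex K a (m + 1))) :=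
    { toFun := fun z => ⟨translate a (θ z.1) z.2.1, translate_mem _ _⟩
      continuous_toFun := by
        rw [continuous_prod_of_discrete_left]
        exact fun k => Continuous.subtype_mk
          ((continuous_translate a (θ k)).comp continuous_subtype_val) _ }
  have hf : ∀ k y, (f (k, y)).1 = translate a (θ k) y.1 := fun _ _ => rfl
  have hfv : ∀ k v, f (k, vertexPoint K v) = vertexPoint (cyclicComplex K a (m + 1)) (θ k + a v) :=
    fun k v => Subtype.ext (translate_vertexPoint _ _)
  have hfq : IsQuotientMap f := by
    refine f.continuous.isClosedMap.isQuotientMap f.continuous fun z => ?_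
    obtain ⟨x, y, hxy⟩ := exists_translate_eq hinj z
    exact ⟨(θ.symm x, y), Subtype.ext (by rw [hf, θ.apply_symm_apply, hxy])⟩
  have hfin : Finite {z : Fin (m + 1) × realization K | z.2 ∈ Set.range (vertexPoint K)} := by
    refine Set.Finite.to_subtype
      ((Set.finite_range fun z : Fin (m + 1) × V => (z.1, vertexPoint K z.2)).subset ?_)
    rintro ⟨k, _⟩ ⟨v, rfl⟩
    exact ⟨(k, v), rfl⟩
  obtain ⟨E₃⟩ := AttachArcs.nonempty_homotopyEquiv_of_identify (φ₀ := φ₀) (φ₁ := φ₁)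
    (C := {z | z.2 = vertexPoint K v₀})
    (by
      intro e e' h
      obtain ⟨h₁, h₂⟩ := Prod.ext_iff.1 h
      exact ε.injective (Prod.ext (θ.symm.injective h₁)
        (Subtype.ext (vertexPoint_injective K h₂))))
    (fun e => rfl) (fun e h => (ε e).2.2 (vertexPoint_injective K h))
    (A := {z | z.2 ∈ Set.range (vertexPoint K)})
    (by
      ext ⟨k, y⟩
      constructor
      · rintro ⟨v, rfl : vertexPoint K v = y⟩
        by_cases hv : v = v₀
        · exact Or.inl (by rw [hv]; rfl)
        · refine Or.inr ⟨ε.symm (θ k, ⟨v, hv⟩), ?_⟩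
          simp [φ₀, i]
      · rintro (h | ⟨e, he⟩)
        · exact ⟨v₀, h.symm⟩
        · exact ⟨(ε e).2, congrArg Prod.snd he⟩)
    (hr'.copies (m + 1)) f hfq
    (by
      intro e
      rw [hfv, hfv]
      simp [i, j])
    (by
      rintro ⟨k, y⟩ ⟨k', y'⟩ h
      have h' : translate a (θ k) y.1 = translate a (θ k') y'.1 := congrArg Subtype.val h
      by_cases hk : k = k'
      · subst hk
        refine Or.inl (Prod.ext rfl (Subtype.ext (funext fun v => ?_)))
        rw [← translate_apply hinj (θ k) y.1, h', translate_apply hinj]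
      · have hk' : θ k ≠ θ k' := fun h => hk (θ.injective h)
        obtain ⟨v, hv⟩ := exists_vertex_of_translate_eq ha hn hk' h'
        obtain ⟨v', hv'⟩ := exists_vertex_of_translate_eq ha hn hk'.symm h'.symm
        exact Or.inr ⟨⟨v, hv.symm⟩, ⟨v', hv'.symm⟩⟩)
    (by
      rintro ⟨k, _⟩ rfl ⟨k', _⟩ rfl h
      rw [hfv, hfv] at h
      have := add_right_cancel (vertexPoint_injective _ h)
      rw [θ.injective this])
  exact ⟨E₃.symm.trans (E₁.trans E₂)⟩

end HomotopyType

end CyclicComplex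

theorem mainTheorem3 {V : Type*} [Fintype V] [Nonempty V] (K : AbstractSimplicialComplex V)
    (hK : IsConnected (CyclicComplex.realization K)) :
    (∃ (n : ℕ) (_ : NeZero n) (L : AbstractSimplicialComplex (ZMod n)),
      CyclicComplex.IsVertexTransitive (Multiplicative (ZMod n)) L ∧
      (∃ l : ℕ, ∀ p : CyclicComplex.realization K,
        Nonempty (CyclicComplex.realization L ≃ₕ
          CyclicComplex.WedgeWithCircles n l (CyclicComplex.realization K) p)) ∧
      ∃ a : V → ℕ, CyclicComplex.IsGolombRuler a ∧ CyclicComplex.IsAdmissibleModulus a n ∧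
        L = CyclicComplex.cyclicComplex K a n) ∧
    ∀ (a : V → ℕ) (n : ℕ) [NeZero n],
      CyclicComplex.IsGolombRuler a → CyclicComplex.IsAdmissibleModulus a n →
      CyclicComplex.IsVertexTransitive (Multiplicative (ZMod n))
        (CyclicComplex.cyclicComplex K a n) ∧
      ∃ l : ℕ, ∀ p : CyclicComplex.realization K,
        Nonempty (CyclicComplex.realization (CyclicComplex.cyclicComplex K a n) ≃ₕ
          CyclicComplex.WedgeWithCircles n l (CyclicComplex.realization K) p) := by
  refine ⟨?_, fun a n _ ha hn => ⟨CyclicComplex.isVertexTransitive_cyclicComplex K a n,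
    CyclicComplex.exists_homotopyEquiv_wedge K hK ha hn⟩⟩
  obtain ⟨a, n, hn₀, ha, hn⟩ :=
    CyclicComplex.exists_isGolombRuler_isAdmissibleModulus (V := V)
  have : NeZero n := ⟨hn₀⟩
  exact ⟨n, this, CyclicComplex.cyclicComplex K a n,
    CyclicComplex.isVertexTransitive_cyclicComplex K a n,
    CyclicComplex.exists_homotopyEquiv_wedge K hK ha hn, a, ha, hn, rfl⟩
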